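/- **Setting.** Let $N>4$ be an integer, $\lambda>0$, $q>1$, $0\le\theta<4$, $C_1,C_2>0$. Let $a,V\in L^1_{loc}(\mathbf R^N)$ be nonnegative a.e. and such that $$V(x)\le \frac{C_1}{|x|^4},\qquad a(x)\ge\frac{C_2}{|x|^\theta}\qquad\text{for a.e. } x \text{ with } |x| \text{ large},$$ and assume the Hardy type inequality $$\lambda_H\int_{\mathbf R^N} v^2V\le\int_{\mathbf R^N}(\Delta v)^2\quad\text{for all } v\in W^{2,2}(\mathbf R^N),\qquad \lambda_H:=\Big(\frac{N(N-4)}4\Big)^2$$ (in particular the left-hand side is finite). A weak solution of $-\Delta^2u+\lambda V(x)u\ge a(x)u^q$ on $\mathbf R^N$ is a function $u\in W^{2,2}_{loc}(\mathbf R^N)\cap L^\infty_{loc}(\mathbf R^N)$ with $$-\int\Delta u\,\Delta\varphi+\int\lambda uV\varphi\ge\int u^q a\,\varphi\qquad\text{for all } \varphi\in C_0^\infty(\mathbf R^N),\ \varphi\ge0 .$$ It is called a weak subharmonic solution if in addition $u\ge0$ and $\Delta u\ge0$ a.e. in $\mathbf R^N$. Here $\Delta$ denotes the weak Laplacian, and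 integrals without a domain are over $\mathbf R^N$. **Lemma.** Let $u$ be a weak subharmonic solution, let $\alpha>2$ and $$1<q<\frac{N+\alpha(4-\theta)-\theta}{N-4}.$$ Then: (i) $u^{q+\alpha}a\in L^1(\mathbf R^N)$ and $u^{\alpha+1}V\in L^1(\mathbf R^N)$; (ii) the weak Laplacian $\Delta(u^\alpha)$ exists as a function in $L^1_{loc}(\mathbf R^N)$, $\Delta u\,\Delta(u^\alpha)\in L^1(\mathbf R^N)$, and $$\int u^{\alpha+q}a+\int\Delta(u^\alpha)\,\Delta u\le\lambda\int u^{\alpha+1}V .$$ -/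

import Mathlib

open MeasureTheory
open scoped ContDiff ENNReal Laplacian

noncomputable section

/-- A test function on `ℝ^N`, that is, an element of `C_0^∞(ℝ^N)`. -/
def IsTestFunction {N : ℕ} (φ : EuclideanSpace ℝ (Fin N) → ℝ) : Prop :=
  ContDiff ℝ ∞ φ ∧ HasCompactSupport φ

/-- `f ∈ L^p_loc(ℝ^N)`. -/
def MemLpLoc {N : ℕ} (f : EuclideanSpace ℝ (Fin N) → ℝ) (p : ℝ≥0∞) : Prop :=
  ∀ K : Set (EuclideanSpace ℝ (Fin N)), IsCompact K → MemLp f p (volume.restrict K)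

/-- `g` is the weak partial derivative `∂f/∂x_i`. -/
def HasWeakPartial {N : ℕ} (i : Fin N) (f g : EuclideanSpace ℝ (Fin N) → ℝ) : Prop :=
  LocallyIntegrable f volume ∧ LocallyIntegrable g volume ∧
    ∀ φ : EuclideanSpace ℝ (Fin N) → ℝ, IsTestFunction φ →
      ∫ x, f x * fderiv ℝ φ x (EuclideanSpace.single i 1) = -∫ x, g x * φ x

/-- `f ∈ W^{2,2}(ℝ^N)`. -/
def MemW22 {N : ℕ} (f : EuclideanSpace ℝ (Fin N) → ℝ) : Prop :=
  MemLp f 2 volume ∧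
    ∃ (G : Fin N → EuclideanSpace ℝ (Fin N) → ℝ)
      (H : Fin N → Fin N → EuclideanSpace ℝ (Fin N) → ℝ),
      (∀ i, MemLp (G i) 2 volume ∧ HasWeakPartial i f (G i)) ∧
      ∀ i j, MemLp (H i j) 2 volume ∧ HasWeakPartial j (G i) (H i j)

/-- `f ∈ W^{2,2}_loc(ℝ^N)`. -/
def MemW22Loc {N : ℕ} (f : EuclideanSpace ℝ (Fin N) → ℝ) : Prop :=
  MemLpLoc f 2 ∧
    ∃ (G : Fin N → EuclideanSpace ℝ (Fin N) → ℝ)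
      (H : Fin N → Fin N → EuclideanSpace ℝ (Fin N) → ℝ),
      (∀ i, MemLpLoc (G i) 2 ∧ HasWeakPartial i f (G i)) ∧
      ∀ i j, MemLpLoc (H i j) 2 ∧ HasWeakPartial j (G i) (H i j)

/-- `g ∈ L^1_loc` is the weak (distributional) Laplacian of `f ∈ L^1_loc`. -/
def HasWeakLaplacian {N : ℕ} (f g : EuclideanSpace ℝ (Fin N) → ℝ) : Prop :=
  LocallyIntegrable f volume ∧ LocallyIntegrable g volume ∧
    ∀ φ : EuclideanSpace ℝ (Fin N) → ℝ, IsTestFunction φ →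
      ∫ x, f x * (Δ φ) x = ∫ x, g x * φ x

open Classical in
/-- The weak Laplacian of `f` (unique up to a null set where it exists); the value `0` is a
placeholder if the distributional Laplacian of `f` is not a locally integrable function. -/
def weakLaplacian {N : ℕ} (f : EuclideanSpace ℝ (Fin N) → ℝ) : EuclideanSpace ℝ (Fin N) → ℝ :=
  if h : ∃ g, HasWeakLaplacian f g then h.choose else 0

theorem HasWeakLaplacian.hasWeakLaplacian_weakLaplacian {N : ℕ}
    {f g : EuclideanSpace ℝ (Fin N) → ℝ} (h : HasWeakLaplacian f g) :
    HasWeakLaplacian f (weakLaplacian f) := by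
  have h' : ∃ g, HasWeakLaplacian f g := ⟨g, h⟩
  rw [weakLaplacian, dif_pos h']
  exact h'.choose_spec

/-- The weak Laplacian is unique up to a null set. -/
theorem HasWeakLaplacian.ae_eq {N : ℕ} {f g : EuclideanSpace ℝ (Fin N) → ℝ}
    (h : HasWeakLaplacian f g) : weakLaplacian f =ᵐ[volume] g := by
  obtain ⟨-, h1, h2⟩ := h.hasWeakLaplacian_weakLaplacian
  refine ae_eq_of_integral_contDiff_smul_eq h1 h.2.1 fun φ hφ hc => ?_
  have e := (h2 φ ⟨hφ, hc⟩).symm.trans (h.2.2 φ ⟨hφ, hc⟩)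
  simpa [mul_comm] using e

/-- The weak Laplacian of a `W^{2,2}_loc` function exists; it is the trace of the weak Hessian. -/
theorem MemW22Loc.hasWeakLaplacian {N : ℕ} {f : EuclideanSpace ℝ (Fin N) → ℝ}
    (hf : MemW22Loc f) (hN : N ≠ 0) : HasWeakLaplacian f (weakLaplacian f) := by
  obtain ⟨-, G, H, hG, hH⟩ := hf
  have hint : ∀ {k φ : EuclideanSpace ℝ (Fin N) → ℝ}, LocallyIntegrable k volume →
      Continuous φ → HasCompactSupport φ → Integrable (fun x => k x * φ x) volume := by
    intro k φ hk hφ hc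
    have := hk.integrable_smul_left_of_hasCompactSupport hφ hc
    simpa [mul_comm] using this
  have hd : ∀ (φ : EuclideanSpace ℝ (Fin N) → ℝ), IsTestFunction φ → ∀ i,
      IsTestFunction (fun x => fderiv ℝ φ x (EuclideanSpace.single i 1)) := by
    intro φ hφ i
    exact ⟨(hφ.1.fderiv_right (m := ∞) (by simp)).clm_apply contDiff_const,
      hφ.2.fderiv_apply (𝕜 := ℝ) _⟩
  refine HasWeakLaplacian.hasWeakLaplacian_weakLaplacian (g := fun x => ∑ i, H i i x)
    ⟨(hG ⟨0, Nat.pos_of_ne_zero hN⟩).2.1, ?_, ?_⟩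
  · exact locallyIntegrable_finsetSum _ fun i _ => (hH i i).2.2.1
  · intro φ hφ
    have hΔ : ∀ x, (Δ φ) x = ∑ i, fderiv ℝ (fun y => fderiv ℝ φ y (EuclideanSpace.single i 1)) x
        (EuclideanSpace.single i 1) := by
      intro x
      rw [InnerProductSpace.laplacian_eq_iteratedFDeriv_orthonormalBasis φ
        (EuclideanSpace.basisFun (Fin N) ℝ)]
      refine Finset.sum_congr rfl fun i _ => ?_
      have hdiff : DifferentiableAt ℝ (fderiv ℝ φ) x :=
        (hφ.1.fderiv_right (m := ∞) (by simp)).differentiable (by simp) x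
      rw [iteratedFDeriv_two_apply, fderiv_clm_apply hdiff (differentiableAt_const _)]
      simp
    have hf1 := (hG ⟨0, Nat.pos_of_ne_zero hN⟩).2.1
    simp only [hΔ, Finset.mul_sum, Finset.sum_mul]
    rw [integral_finsetSum _ fun i _ => hint hf1 (hd _ (hd φ hφ i) i).1.continuous
        (hd _ (hd φ hφ i) i).2,
      integral_finsetSum _ fun i _ => hint (hH i i).2.2.1 hφ.1.continuous hφ.2]
    refine Finset.sum_congr rfl fun i _ => ?_
    rw [(hG i).2.2.2 _ (hd φ hφ i), (hH i i).2.2.2 φ hφ, neg_neg]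

/-- The constant `λ_H = (N (N - 4) / 4)²`. -/
def hardyConstant (N : ℕ) : ℝ := ((N : ℝ) * ((N : ℝ) - 4) / 4) ^ 2

/-- The Hardy type inequality `λ_H ∫ v² V ≤ ∫ (Δv)²` for all `v ∈ W^{2,2}(ℝ^N)`; in particular
the left-hand side is finite. -/
def HardyInequality {N : ℕ} (V : EuclideanSpace ℝ (Fin N) → ℝ) : Prop :=
  ∀ v : EuclideanSpace ℝ (Fin N) → ℝ, MemW22 v →
    Integrable (fun x => v x ^ 2 * V x) volume ∧
      hardyConstant N * ∫ x, v x ^ 2 * V x ≤ ∫ x, (weakLaplacian v x) ^ 2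

/-- `u` is a weak solution of `-Δ²u + lam V u ≥ a u^q` on `ℝ^N`. -/
structure IsWeakSolution {N : ℕ} (lam q : ℝ) (V a u : EuclideanSpace ℝ (Fin N) → ℝ) : Prop where
  memW22Loc : MemW22Loc u
  memLinftyLoc : MemLpLoc u ∞
  ineq : ∀ φ : EuclideanSpace ℝ (Fin N) → ℝ, IsTestFunction φ → (∀ x, 0 ≤ φ x) →
    ∫ x, u x ^ q * a x * φ x ≤
      -(∫ x, weakLaplacian u x * (Δ φ) x) + ∫ x, lam * u x * V x * φ x

/-- `u` is a weak subharmonic solution: a weak solution with `u ≥ 0` and `Δu ≥ 0` a.e. -/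
structure IsWeakSubharmonicSolution {N : ℕ} (lam q : ℝ)
    (V a u : EuclideanSpace ℝ (Fin N) → ℝ) : Prop extends IsWeakSolution lam q V a u where
  nonneg : ∀ᵐ x, 0 ≤ u x
  laplacian_nonneg : ∀ᵐ x, 0 ≤ weakLaplacian u x

end

/-!
Formally one tests the inequality with `u ^ α ψ`, where `ψ = η ^ (k + 4)` is a cutoff at scale `R`.
As `Δu ≥ 0`, the term `∫ Δu Δ(u ^ α) ψ` is nonnegative and controls `α ∫ u ^ (α - 1) (Δu)² ψ`. The
terms that contain derivatives of `ψ` are `2 α ∫ Δu u ^ (α - 1) ∇u · ∇ψ` and `∫ Δu u ^ α Δψ`; by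
Cauchy-Schwarz they are at most a small multiple of `∫ u ^ (α - 1) (Δu)² ψ` plus a large multiple of
`∫ u ^ (α - 1) |∇u|² χ` and `∫ u ^ (α + 1) Θ`, with `χ` and `Θ` as in `IsCutoff`. Since
`Δ(u ^ (α + 1)) ≥ α u ^ (α - 1) |∇u|²`, the gradient term is at most `∫ u ^ (α + 1) |Δχ|`
(`integral_rpow_mul_gradient_sq_le`), so the error is of the order of
`∫ u ^ (α + 1) ‖x‖⁻⁴ η ^ k` over `‖x‖ ≥ R`. Young's inequality (`exists_young_weighted`) bounds this by
a small multiple of `∫ a u ^ (q + α) ψ`, because `a ≥ C₂ ‖x‖ ^ (-θ)`, plus the integral over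
`‖x‖ ≥ R` of `(1 + ‖x‖) ^ (-s)` with `s = (4 - θ) (q + α) / (q - 1) + θ`. The upper bound on `q` says
precisely that `s > N`, so this remainder tends to `0` as `R → ∞`. The bound `V ≤ C₁ ‖x‖⁻⁴` allows
the same absorption for the potential term, which gives the integrability assertions, and the
inequality follows with `R → ∞` (`integrable_and_add_le_of_cutoff`).

The test function is made legitimate by mollification. If `w n` are the mollifications of `u` plus a
small positive constant, then `(w n) ^ α ψ` is a smooth test function, and `w n` is positive and
subharmonic, so that the estimates above are classical computations for `w n`
(`energy_inequality_of_smooth`). In the limit `n → ∞`, the term `∫ Δu Δ((w n) ^ α) ψ` has a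
nonnegative integrand, and Fatou's lemma suffices; the terms with powers of `w n` alone converge by
dominated convergence, as `u` is locally bounded (`IsSmoothApprox.energy_inequality`). The chain rule
for the weak Laplacian of `u ^ α` needs convergence of `|∇(w n)|²` in the mean, which follows from
Jensen's inequality and dominated convergence with varying dominating functions
(`IsSmoothApprox.hasWeakLaplacian_rpow`).
-/

/-! ### Passing to the limit in integrals -/

section Limits

open Filter Topology

variable {X : Type*} [MeasurableSpace X] {μ : Measure X}

/-- Fatou's lemma for Bochner integrals of nonnegative functions, with the integrability of the
limit as part of the conclusion. -/
theorem integrable_and_integral_le_of_tendsto {F : ℕ → X → ℝ} {f : X → ℝ} {b : ℕ → ℝ} {c : ℝ}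
    (hF : ∀ n, Integrable (F n) μ) (h0 : ∀ n, ∀ᵐ x ∂μ, 0 ≤ F n x)
    (hlim : ∀ᵐ x ∂μ, Tendsto (fun n => F n x) atTop (𝓝 (f x)))
    (hb : ∀ n, ∫ x, F n x ∂μ ≤ b n) (hc : Tendsto b atTop (𝓝 c)) :
    Integrable f μ ∧ ∫ x, f x ∂μ ≤ c := by
  have hm : AEStronglyMeasurable f μ :=
    aestronglyMeasurable_of_tendsto_ae atTop (fun n => (hF n).1) hlim
  have hall : ∀ᵐ x ∂μ, ∀ n, 0 ≤ F n x := ae_all_iff.2 h0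
  have hf0 : 0 ≤ᵐ[μ] f := by
    filter_upwards [hall, hlim] with x hx hl
    exact ge_of_tendsto' hl hx
  have key : ∫⁻ x, ENNReal.ofReal (f x) ∂μ ≤ ENNReal.ofReal c := by
    calc ∫⁻ x, ENNReal.ofReal (f x) ∂μ
        = ∫⁻ x, liminf (fun n => ENNReal.ofReal (F n x)) atTop ∂μ := by
          refine lintegral_congr_ae ?_
          filter_upwards [hlim] with x hl
          exact (ENNReal.tendsto_ofReal hl).liminf_eq.symm
      _ ≤ liminf (fun n => ∫⁻ x, ENNReal.ofReal (F n x) ∂μ) atTop :=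
          lintegral_liminf_le' fun n => (hF n).1.aemeasurable.ennreal_ofReal
      _ ≤ liminf (fun n => ENNReal.ofReal (b n)) atTop := by
          refine liminf_le_liminf (Eventually.of_forall fun n => ?_)
          rw [← ofReal_integral_eq_lintegral_ofReal (hF n) (h0 n)]
          exact ENNReal.ofReal_le_ofReal (hb n)
      _ = ENNReal.ofReal c := (ENNReal.tendsto_ofReal hc).liminf_eq
  have hint : Integrable f μ :=
    (lintegral_ofReal_ne_top_iff_integrable hm hf0).1 (key.trans_lt ENNReal.ofReal_lt_top).ne
  have hc0 : 0 ≤ c := ge_of_tendsto' hc fun n => (integral_nonneg_of_ae (h0 n)).trans (hb n)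
  refine ⟨hint, ?_⟩
  rw [← ofReal_integral_eq_lintegral_ofReal hint hf0] at key
  exact (ENNReal.ofReal_le_ofReal_iff hc0).1 key

/-- Dominated convergence with dominating functions that vary with `n`, converge almost everywhere,
and whose integrals converge to the integral of their limit. -/
theorem tendsto_integral_of_tendsto_dominating {F G : ℕ → X → ℝ} {f g : X → ℝ}
    (hF : ∀ n, AEStronglyMeasurable (F n) μ) (hG : ∀ n, Integrable (G n) μ) (hg : Integrable g μ)
    (hFG : ∀ n, ∀ᵐ x ∂μ, |F n x| ≤ G n x)
    (hFlim : ∀ᵐ x ∂μ, Tendsto (fun n => F n x) atTop (𝓝 (f x)))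
    (hGlim : ∀ᵐ x ∂μ, Tendsto (fun n => G n x) atTop (𝓝 (g x)))
    (hGint : Tendsto (fun n => ∫ x, G n x ∂μ) atTop (𝓝 (∫ x, g x ∂μ))) :
    Tendsto (fun n => ∫ x, F n x ∂μ) atTop (𝓝 (∫ x, f x ∂μ)) := by
  have hall : ∀ᵐ x ∂μ, ∀ n, |F n x| ≤ G n x := ae_all_iff.2 hFG
  have hg0 : ∀ᵐ x ∂μ, 0 ≤ g x := by
    filter_upwards [hall, hGlim] with x hx hl
    exact ge_of_tendsto' hl fun n => (abs_nonneg _).trans (hx n)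
  have hfg : ∀ᵐ x ∂μ, |f x| ≤ g x := by
    filter_upwards [hall, hGlim, hFlim] with x hx hl hl'
    exact le_of_tendsto_of_tendsto' hl'.abs hl hx
  have hmin : Tendsto (fun n => ∫ x, min (G n x) (g x) ∂μ) atTop (𝓝 (∫ x, g x ∂μ)) := by
    refine tendsto_integral_of_dominated_convergence g
      (fun n => ((hG n).inf hg).1) hg (fun n => ?_) ?_
    · filter_upwards [hall, hg0] with x hx h0
      have h1 := (abs_nonneg _).trans (hx n)
      rw [Real.norm_of_nonneg (le_min h1 h0)]
      exact min_le_right _ _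
    · filter_upwards [hGlim] with x hl
      simpa using hl.min (tendsto_const_nhds (x := g x))
  -- the truncations of `F n` to `[-g, g]` are dominated by `g`
  have htr : Tendsto (fun n => ∫ x, max (min (F n x) (g x)) (-g x) ∂μ) atTop
      (𝓝 (∫ x, f x ∂μ)) := by
    refine tendsto_integral_of_dominated_convergence g
      (fun n => ((hF n).inf hg.1).sup hg.1.neg) hg (fun n => ?_) ?_
    · filter_upwards [hg0] with x h0
      rw [Real.norm_eq_abs, abs_le]
      exact ⟨le_max_right _ _, max_le (min_le_right _ _) (by linarith)⟩
    · filter_upwards [hFlim, hfg] with x hl hx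
      have := (hl.min (tendsto_const_nhds (x := g x))).max (tendsto_const_nhds (x := -g x))
      rwa [min_eq_left (abs_le.1 hx).2, max_eq_left (abs_le.1 hx).1] at this
  have hdiff : Tendsto (fun n => ∫ x, (F n x - max (min (F n x) (g x)) (-g x)) ∂μ) atTop (𝓝 0) := by
    have hz : Tendsto (fun n => ∫ x, G n x ∂μ - ∫ x, min (G n x) (g x) ∂μ) atTop (𝓝 0) := by
      simpa using hGint.sub hmin
    refine squeeze_zero_norm (fun n => ?_) hz
    have hmi : Integrable (fun x => min (G n x) (g x)) μ := (hG n).inf hg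
    rw [← integral_sub (hG n) hmi]
    refine norm_integral_le_of_norm_le ((hG n).sub hmi) ?_
    filter_upwards [hall, hg0] with x hx h0
    obtain ⟨h1, h2⟩ := abs_le.1 (hx n)
    rw [Real.norm_eq_abs, abs_le]
    rcases le_total (F n x) (g x) with h3 | h3 <;> rcases le_total (G n x) (g x) with h4 | h4 <;>
      rcases le_total (F n x) (-g x) with h5 | h5 <;>
      simp only [min_eq_left, min_eq_right, max_eq_left, max_eq_right, *] <;>
      (first | (constructor <;> linarith) |
        (rw [max_eq_left (by linarith)]; constructor <;> linarith))
  have hFi : ∀ n, Integrable (F n) μ := fun n =>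
    (hG n).mono' (hF n) (by simpa only [Real.norm_eq_abs] using hFG n)
  have hTi : ∀ n, Integrable (fun x => max (min (F n x) (g x)) (-g x)) μ := fun n =>
    ((hFi n).inf hg).sup hg.neg
  have := hdiff.add htr
  simp only [zero_add] at this
  refine this.congr fun n => ?_
  rw [integral_sub (hFi n) (hTi n), sub_add_cancel]

end Limits

/-! ### Partial derivatives and the Laplacian of smooth functions -/

section Calculus

variable {N : ℕ}

/-- The partial derivative `∂f/∂x_i`. -/
noncomputable def partialDeriv (i : Fin N) (f : EuclideanSpace ℝ (Fin N) → ℝ)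
    (x : EuclideanSpace ℝ (Fin N)) : ℝ :=
  fderiv ℝ f x (EuclideanSpace.single i 1)

theorem ContDiff.partialDeriv {f : EuclideanSpace ℝ (Fin N) → ℝ} (hf : ContDiff ℝ ∞ f)
    (i : Fin N) : ContDiff ℝ ∞ (partialDeriv i f) :=
  (hf.fderiv_right (m := ∞) (by simp)).clm_apply contDiff_const

theorem HasCompactSupport.partialDeriv {f : EuclideanSpace ℝ (Fin N) → ℝ}
    (hf : HasCompactSupport f) (i : Fin N) : HasCompactSupport (partialDeriv i f) :=
  hf.fderiv_apply (𝕜 := ℝ) _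

theorem IsTestFunction.partialDeriv {f : EuclideanSpace ℝ (Fin N) → ℝ}
    (hf : IsTestFunction f) (i : Fin N) : IsTestFunction (partialDeriv i f) :=
  ⟨hf.1.partialDeriv i, hf.2.partialDeriv i⟩

theorem ContDiff.laplacian_eq_sum {f : EuclideanSpace ℝ (Fin N) → ℝ} (hf : ContDiff ℝ ∞ f)
    (x : EuclideanSpace ℝ (Fin N)) :
    (Δ f) x = ∑ i, _root_.partialDeriv i (_root_.partialDeriv i f) x := by
  rw [InnerProductSpace.laplacian_eq_iteratedFDeriv_orthonormalBasis f
    (EuclideanSpace.basisFun (Fin N) ℝ)]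
  refine Finset.sum_congr rfl fun i _ => ?_
  have hdiff : DifferentiableAt ℝ (fderiv ℝ f) x :=
    (hf.fderiv_right (m := ∞) (by simp)).differentiable (by simp) x
  unfold _root_.partialDeriv
  rw [iteratedFDeriv_two_apply, fderiv_clm_apply hdiff (differentiableAt_const _)]
  simp

theorem ContDiff.laplacian {f : EuclideanSpace ℝ (Fin N) → ℝ} (hf : ContDiff ℝ ∞ f) :
    ContDiff ℝ ∞ (Δ f) := by
  rw [show (Δ f) = fun x => ∑ i, _root_.partialDeriv i (_root_.partialDeriv i f) x from
    funext hf.laplacian_eq_sum]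
  exact ContDiff.sum fun i _ => (hf.partialDeriv i).partialDeriv i

theorem IsTestFunction.laplacian {f : EuclideanSpace ℝ (Fin N) → ℝ}
    (hf : IsTestFunction f) : IsTestFunction (Δ f) := by
  refine ⟨hf.1.laplacian, hf.2.mono' fun x hx => ?_⟩
  by_contra h
  have hz : f =ᶠ[nhds x] 0 := notMem_tsupport_iff_eventuallyEq.1 h
  refine hx ?_
  rw [(InnerProductSpace.laplacian_congr_nhds hz).eq_of_nhds]
  exact congrFun (InnerProductSpace.laplacian_const (c := (0 : ℝ))) x

theorem partialDeriv_mul {f g : EuclideanSpace ℝ (Fin N) → ℝ} (hf : ContDiff ℝ ∞ f)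
    (hg : ContDiff ℝ ∞ g) (i : Fin N) (x : EuclideanSpace ℝ (Fin N)) :
    partialDeriv i (fun y => f y * g y) x =
      partialDeriv i f x * g x + f x * partialDeriv i g x := by
  unfold partialDeriv
  rw [fderiv_fun_mul (hf.differentiable (by simp) x) (hg.differentiable (by simp) x)]
  simp only [add_apply, smul_apply, smul_eq_mul]
  ring

theorem partialDeriv_add {f g : EuclideanSpace ℝ (Fin N) → ℝ} (hf : ContDiff ℝ ∞ f)
    (hg : ContDiff ℝ ∞ g) (i : Fin N) (x : EuclideanSpace ℝ (Fin N)) :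
    partialDeriv i (fun y => f y + g y) x = partialDeriv i f x + partialDeriv i g x := by
  unfold partialDeriv
  rw [fderiv_fun_add (hf.differentiable (by simp) x) (hg.differentiable (by simp) x)]
  simp

theorem partialDeriv_comp {w : EuclideanSpace ℝ (Fin N) → ℝ} (hw : ContDiff ℝ ∞ w)
    {F : ℝ → ℝ} {d : ℝ} (i : Fin N) {x : EuclideanSpace ℝ (Fin N)}
    (hF : HasDerivAt F d (w x)) :
    partialDeriv i (fun y => F (w y)) x = d * partialDeriv i w x := by
  unfold partialDeriv
  have h := hF.comp_hasFDerivAt x (hw.differentiable (by simp) x).hasFDerivAt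
  rw [show (fun y => F (w y)) = F ∘ w from rfl, h.fderiv]
  simp

/-- `Δ(f g) = g Δf + 2 ∇f · ∇g + f Δg`. -/
theorem laplacian_mul_apply {f g : EuclideanSpace ℝ (Fin N) → ℝ} (hf : ContDiff ℝ ∞ f)
    (hg : ContDiff ℝ ∞ g) (x : EuclideanSpace ℝ (Fin N)) :
    (Δ fun y => f y * g y) x =
      (Δ f) x * g x + 2 * ∑ i, partialDeriv i f x * partialDeriv i g x + f x * (Δ g) x := by
  rw [(hf.mul hg).laplacian_eq_sum, hf.laplacian_eq_sum, hg.laplacian_eq_sum, Finset.sum_mul,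
    Finset.mul_sum, Finset.mul_sum, ← Finset.sum_add_distrib, ← Finset.sum_add_distrib]
  refine Finset.sum_congr rfl fun i _ => ?_
  rw [show partialDeriv i (fun y => f y * g y) = fun y =>
      partialDeriv i f y * g y + f y * partialDeriv i g y from
      funext (partialDeriv_mul hf hg i),
    partialDeriv_add ((hf.partialDeriv i).mul hg) (hf.mul (hg.partialDeriv i)),
    partialDeriv_mul (hf.partialDeriv i) hg, partialDeriv_mul hf (hg.partialDeriv i)]
  ring

/-- The chain rule `Δ(F ∘ w) = F'(w) Δw + F''(w) |∇w|²`. -/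
theorem laplacian_comp_apply {w : EuclideanSpace ℝ (Fin N) → ℝ} (hw : ContDiff ℝ ∞ w)
    {F F' F'' : ℝ → ℝ} (hF : ContDiff ℝ ∞ fun y => F (w y)) (hF' : ContDiff ℝ ∞ fun y => F' (w y))
    (h1 : ∀ x, HasDerivAt F (F' (w x)) (w x)) (h2 : ∀ x, HasDerivAt F' (F'' (w x)) (w x))
    (x : EuclideanSpace ℝ (Fin N)) :
    (Δ fun y => F (w y)) x =
      F' (w x) * (Δ w) x + F'' (w x) * ∑ i, partialDeriv i w x ^ 2 := by
  rw [hF.laplacian_eq_sum, hw.laplacian_eq_sum, Finset.mul_sum, Finset.mul_sum,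
    ← Finset.sum_add_distrib]
  refine Finset.sum_congr rfl fun i _ => ?_
  rw [show partialDeriv i (fun y => F (w y)) = fun y => F' (w y) * partialDeriv i w y from
      funext fun y => partialDeriv_comp hw i (h1 y),
    partialDeriv_mul hF' (hw.partialDeriv i), partialDeriv_comp hw i (h2 x)]
  ring

theorem laplacian_rpow_apply {w : EuclideanSpace ℝ (Fin N) → ℝ} (hw : ContDiff ℝ ∞ w)
    (hpos : ∀ x, 0 < w x) (β : ℝ) (x : EuclideanSpace ℝ (Fin N)) :
    (Δ fun y => w y ^ β) x = β * w x ^ (β - 1) * (Δ w) x +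
      β * (β - 1) * w x ^ (β - 2) * ∑ i, partialDeriv i w x ^ 2 := by
  have hne : ∀ x, w x ≠ 0 := fun x => (hpos x).ne'
  refine laplacian_comp_apply hw (F := fun t => t ^ β) (F' := fun t => β * t ^ (β - 1))
    (F'' := fun t => β * (β - 1) * t ^ (β - 2)) (hw.rpow_const_of_ne hne)
    (contDiff_const.mul (hw.rpow_const_of_ne hne))
    (fun y => Real.hasDerivAt_rpow_const (Or.inl (hne y))) (fun y => ?_) x
  have h := (Real.hasDerivAt_rpow_const (p := β - 1) (Or.inl (hne y))).const_mul β
  rw [show β - 1 - 1 = β - 2 by ring, ← mul_assoc] at h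
  exact h

theorem laplacian_pow_apply {w : EuclideanSpace ℝ (Fin N) → ℝ} (hw : ContDiff ℝ ∞ w)
    (k : ℕ) (x : EuclideanSpace ℝ (Fin N)) :
    (Δ fun y => w y ^ (k + 2)) x = ((k : ℝ) + 2) * w x ^ (k + 1) * (Δ w) x +
      ((k : ℝ) + 2) * ((k : ℝ) + 1) * w x ^ k * ∑ i, partialDeriv i w x ^ 2 := by
  refine laplacian_comp_apply hw (F := fun t => t ^ (k + 2))
    (F' := fun t => ((k : ℝ) + 2) * t ^ (k + 1))
    (F'' := fun t => ((k : ℝ) + 2) * ((k : ℝ) + 1) * t ^ k) (hw.pow _)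
    (contDiff_const.mul (hw.pow _)) (fun y => ?_) (fun y => ?_) x
  · have h := hasDerivAt_pow (k + 2) (w y)
    simpa using h
  · have h := (hasDerivAt_pow (k + 1) (w y)).const_mul ((k : ℝ) + 2)
    rw [← mul_assoc] at h
    simpa using h

theorem integral_mul_partialDeriv {f φ : EuclideanSpace ℝ (Fin N) → ℝ} (hf : ContDiff ℝ ∞ f)
    (hφ : IsTestFunction φ) (i : Fin N) :
    ∫ x, f x * partialDeriv i φ x = -∫ x, partialDeriv i f x * φ x := by
  refine integral_mul_fderiv_eq_neg_fderiv_mul_of_integrable ?_ ?_ ?_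
    (fun x _ => hf.differentiable (by simp) x) (fun x _ => hφ.1.differentiable (by simp) x)
  · exact ((hf.partialDeriv i).continuous.mul hφ.1.continuous).integrable_of_hasCompactSupport
      hφ.2.mul_left
  · exact (hf.continuous.mul (hφ.1.partialDeriv i).continuous).integrable_of_hasCompactSupport
      (hφ.2.partialDeriv i).mul_left
  · exact (hf.continuous.mul hφ.1.continuous).integrable_of_hasCompactSupport hφ.2.mul_left

/-- Green's formula against a test function. -/
theorem integral_mul_laplacian {f φ : EuclideanSpace ℝ (Fin N) → ℝ} (hf : ContDiff ℝ ∞ f)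
    (hφ : IsTestFunction φ) : ∫ x, f x * (Δ φ) x = ∫ x, (Δ f) x * φ x := by
  simp only [hφ.1.laplacian_eq_sum, hf.laplacian_eq_sum, Finset.mul_sum, Finset.sum_mul]
  rw [integral_finsetSum, integral_finsetSum]
  · refine Finset.sum_congr rfl fun i _ => ?_
    rw [integral_mul_partialDeriv hf (hφ.partialDeriv i),
      integral_mul_partialDeriv (hf.partialDeriv i) hφ, neg_neg]
  · exact fun i _ => (((hf.partialDeriv i).partialDeriv i).continuous.mul
      hφ.1.continuous).integrable_of_hasCompactSupport hφ.2.mul_left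
  · exact fun i _ => (hf.continuous.mul ((hφ.1.partialDeriv i).partialDeriv
      i).continuous).integrable_of_hasCompactSupport ((hφ.2.partialDeriv i).partialDeriv i).mul_left

end Calculus

/-! ### Mollification -/

section Mollification

open Filter Topology ContinuousLinearMap
open scoped Convolution

variable {N : ℕ}

/-- A bump function supported in the ball of radius `1 / (n + 1)`; the ratio of the two radii is
fixed, as the almost everywhere convergence of the mollifications requires. -/
noncomputable def shrinkingBump (N n : ℕ) : ContDiffBump (0 : EuclideanSpace ℝ (Fin N)) where
  rIn := 1 / (n + 1) / 2
  rOut := 1 / (n + 1)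
  rIn_pos := by positivity
  rIn_lt_rOut := half_lt_self (by positivity)

/-- The smooth kernel of mass one given by `shrinkingBump`. -/
noncomputable def mollifier (N n : ℕ) : EuclideanSpace ℝ (Fin N) → ℝ :=
  (shrinkingBump N n).normed volume

/-- The convolution of `f` with `mollifier N n`. -/
noncomputable def mollify (n : ℕ) (f : EuclideanSpace ℝ (Fin N) → ℝ) :
    EuclideanSpace ℝ (Fin N) → ℝ :=
  f ⋆[lsmul ℝ ℝ, volume] mollifier N n

theorem mollify_apply (n : ℕ) (f : EuclideanSpace ℝ (Fin N) → ℝ) (x : EuclideanSpace ℝ (Fin N)) :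
    mollify n f x = ∫ t, f t * mollifier N n (x - t) :=
  convolution_lsmul

theorem isTestFunction_mollifier (n : ℕ) : IsTestFunction (mollifier N n) :=
  ⟨(shrinkingBump N n).contDiff_normed, (shrinkingBump N n).hasCompactSupport_normed⟩

theorem mollifier_nonneg (n : ℕ) (x : EuclideanSpace ℝ (Fin N)) : 0 ≤ mollifier N n x :=
  (shrinkingBump N n).nonneg_normed x

theorem mollifier_neg (n : ℕ) (x : EuclideanSpace ℝ (Fin N)) :
    mollifier N n (-x) = mollifier N n x :=
  (shrinkingBump N n).normed_neg x

theorem integral_mollifier_sub (n : ℕ) (x : EuclideanSpace ℝ (Fin N)) :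
    ∫ t, mollifier N n (x - t) = 1 := by
  rw [integral_sub_left_eq_self (mollifier N n) volume x]
  exact (shrinkingBump N n).integral_normed

theorem mollifier_eq_zero (n : ℕ) {x : EuclideanSpace ℝ (Fin N)} (hx : 1 < ‖x‖) :
    mollifier N n x = 0 := by
  by_contra h
  have h1 : x ∈ Function.support ((shrinkingBump N n).normed volume) := h
  rw [(shrinkingBump N n).support_normed_eq, Metric.mem_ball, dist_zero_right] at h1
  have h2 : (shrinkingBump N n).rOut ≤ 1 := by
    change 1 / ((n : ℝ) + 1) ≤ 1
    rw [div_le_one (by positivity)]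
    linarith [(Nat.cast_nonneg n : (0 : ℝ) ≤ n)]
  linarith

theorem IsTestFunction.comp_sub_left {φ : EuclideanSpace ℝ (Fin N) → ℝ} (hφ : IsTestFunction φ)
    (x : EuclideanSpace ℝ (Fin N)) : IsTestFunction fun t => φ (x - t) :=
  ⟨hφ.1.comp (contDiff_const.sub contDiff_id),
    hφ.2.comp_homeomorph (Homeomorph.subLeft x)⟩

theorem partialDeriv_comp_sub_left {φ : EuclideanSpace ℝ (Fin N) → ℝ} (hφ : ContDiff ℝ ∞ φ)
    (i : Fin N) (x t : EuclideanSpace ℝ (Fin N)) :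
    partialDeriv i (fun t => φ (x - t)) t = -partialDeriv i φ (x - t) := by
  unfold partialDeriv
  have h := (hφ.differentiable (by simp) (x - t)).hasFDerivAt.comp t
    ((hasFDerivAt_const x t).sub (hasFDerivAt_id t))
  rw [show (fun t => φ (x - t)) = φ ∘ (HSub.hSub x) from rfl, h.fderiv]
  simp

theorem integrable_mul_of_hasCompactSupport {f φ : EuclideanSpace ℝ (Fin N) → ℝ}
    (hf : LocallyIntegrable f volume) (hφ : Continuous φ) (hc : HasCompactSupport φ) :
    Integrable fun t => f t * φ t := by
  have := hf.integrable_smul_left_of_hasCompactSupport hφ hc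
  simpa [mul_comm] using this

theorem integrable_mul_mollifier {f : EuclideanSpace ℝ (Fin N) → ℝ}
    (hf : LocallyIntegrable f volume) (n : ℕ) (x : EuclideanSpace ℝ (Fin N)) :
    Integrable fun t => f t * mollifier N n (x - t) :=
  have h := (isTestFunction_mollifier n).comp_sub_left x
  integrable_mul_of_hasCompactSupport hf h.1.continuous h.2

theorem contDiff_mollify {f : EuclideanSpace ℝ (Fin N) → ℝ} (hf : LocallyIntegrable f volume)
    (n : ℕ) : ContDiff ℝ ∞ (mollify n f) :=
  (isTestFunction_mollifier n).2.contDiff_convolution_right (n := ⊤) _ hf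
    (isTestFunction_mollifier n).1

theorem ae_tendsto_mollify {f : EuclideanSpace ℝ (Fin N) → ℝ} (hf : LocallyIntegrable f volume) :
    ∀ᵐ x, Tendsto (fun n => mollify n f x) atTop (𝓝 (f x)) := by
  have h := ContDiffBump.ae_convolution_tendsto_right_of_locallyIntegrable (μ := volume)
    (φ := shrinkingBump N) (l := atTop) (K := 2) (g := f)
    tendsto_one_div_add_atTop_nhds_zero_nat
    (Eventually.of_forall fun n => by
      change 1 / ((n : ℝ) + 1) ≤ 2 * (1 / (n + 1) / 2)
      rw [mul_div_cancel₀ _ two_ne_zero]) hf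
  filter_upwards [h] with x hx
  refine hx.congr fun n => ?_
  rw [mollify_apply, convolution_lsmul_swap]
  exact integral_congr_ae (Eventually.of_forall fun t => mul_comm _ _)

theorem tendsto_mollify_of_continuous {f : EuclideanSpace ℝ (Fin N) → ℝ} (hf : Continuous f)
    (x : EuclideanSpace ℝ (Fin N)) : Tendsto (fun n => mollify n f x) atTop (𝓝 (f x)) := by
  have h := ContDiffBump.convolution_tendsto_right_of_continuous (μ := volume)
    (φ := shrinkingBump N) (l := atTop) (g := f)
    tendsto_one_div_add_atTop_nhds_zero_nat hf x
  refine h.congr fun n => ?_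
  rw [mollify_apply, convolution_lsmul_swap]
  exact integral_congr_ae (Eventually.of_forall fun t => mul_comm _ _)

theorem mollify_nonneg {f : EuclideanSpace ℝ (Fin N) → ℝ} (hf : ∀ᵐ x, 0 ≤ f x) (n : ℕ)
    (x : EuclideanSpace ℝ (Fin N)) : 0 ≤ mollify n f x := by
  rw [mollify_apply]
  refine integral_nonneg_of_ae ?_
  filter_upwards [hf] with t ht
  exact mul_nonneg ht (mollifier_nonneg n _)

theorem abs_mollify_le {f : EuclideanSpace ℝ (Fin N) → ℝ} {c : ℝ} {x : EuclideanSpace ℝ (Fin N)}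
    (hc : ∀ᵐ t, ‖x - t‖ ≤ 1 → |f t| ≤ c) (n : ℕ) : |mollify n f x| ≤ c := by
  have h := (isTestFunction_mollifier (N := N) n).comp_sub_left x
  have hi : Integrable fun t => c * mollifier N n (x - t) :=
    (h.1.continuous.integrable_of_hasCompactSupport h.2).const_mul c
  have h1 : ∫ t, c * mollifier N n (x - t) = c := by
    rw [integral_const_mul, integral_mollifier_sub, mul_one]
  rw [mollify_apply, ← h1, ← Real.norm_eq_abs]
  refine norm_integral_le_of_norm_le hi ?_
  filter_upwards [hc] with t ht
  rw [Real.norm_eq_abs, abs_mul, abs_of_nonneg (mollifier_nonneg n _)]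
  by_cases h2 : ‖x - t‖ ≤ 1
  · exact mul_le_mul_of_nonneg_right (ht h2) (mollifier_nonneg n _)
  · simp [mollifier_eq_zero n (not_le.1 h2)]

/-- Jensen's inequality for the square. -/
theorem mollify_sq_le {f : EuclideanSpace ℝ (Fin N) → ℝ} (hf : LocallyIntegrable f volume)
    (hf2 : LocallyIntegrable (fun x => f x ^ 2) volume) (n : ℕ) (x : EuclideanSpace ℝ (Fin N)) :
    mollify n f x ^ 2 ≤ mollify n (fun x => f x ^ 2) x := by
  set c := mollify n f x with hc
  have h := (isTestFunction_mollifier (N := N) n).comp_sub_left x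
  have h1 : Integrable fun t => c ^ 2 * mollifier N n (x - t) :=
    (h.1.continuous.integrable_of_hasCompactSupport h.2).const_mul _
  have h2 := integrable_mul_mollifier hf2 n x
  have h3 := (integrable_mul_mollifier hf n x).const_mul (2 * c)
  have h4 : 0 ≤ ∫ t, ((f t ^ 2 * mollifier N n (x - t) -
      2 * c * (f t * mollifier N n (x - t))) + c ^ 2 * mollifier N n (x - t)) := by
    refine integral_nonneg fun t => ?_
    have : 0 ≤ (f t - c) ^ 2 * mollifier N n (x - t) :=
      mul_nonneg (sq_nonneg _) (mollifier_nonneg n _)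
    simp only [Pi.zero_apply]
    linarith
  have h23 : Integrable fun t => f t ^ 2 * mollifier N n (x - t) -
      2 * c * (f t * mollifier N n (x - t)) := h2.sub h3
  rw [integral_add h23 h1, integral_sub h2 h3, integral_const_mul, integral_const_mul,
    integral_mollifier_sub, ← mollify_apply, ← mollify_apply, ← hc] at h4
  linarith

theorem partialDeriv_convolution {f : EuclideanSpace ℝ (Fin N) → ℝ}
    (hf : LocallyIntegrable f volume) {φ : EuclideanSpace ℝ (Fin N) → ℝ} (hφ : IsTestFunction φ)
    (i : Fin N) :
    partialDeriv i (f ⋆[lsmul ℝ ℝ, volume] φ) = f ⋆[lsmul ℝ ℝ, volume] partialDeriv i φ := by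
  ext x
  unfold partialDeriv
  rw [(hφ.2.hasFDerivAt_convolution_right (lsmul ℝ ℝ) hf (hφ.1.of_le (by simp)) x).fderiv,
    convolution_precompR_apply _ hf (hφ.2.fderiv ℝ) (hφ.1.continuous_fderiv (by simp))]

theorem partialDeriv_mollify {i : Fin N} {f g : EuclideanSpace ℝ (Fin N) → ℝ}
    (h : HasWeakPartial i f g) (n : ℕ) : partialDeriv i (mollify n f) = mollify n g := by
  have hρ := isTestFunction_mollifier (N := N) n
  ext x
  have h1 := h.2.2 _ (hρ.comp_sub_left x)
  rw [mollify_apply, ← neg_eq_iff_eq_neg.2 h1, mollify, partialDeriv_convolution h.1 hρ,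
    convolution_lsmul, ← integral_neg]
  refine integral_congr_ae (Eventually.of_forall fun t => ?_)
  have := partialDeriv_comp_sub_left hρ.1 i x t
  unfold partialDeriv at this
  simp only [this, smul_eq_mul, partialDeriv]
  ring

theorem laplacian_mollify {f g : EuclideanSpace ℝ (Fin N) → ℝ}
    (h : HasWeakLaplacian f g) (n : ℕ) : (Δ (mollify n f)) = mollify n g := by
  have hρ := isTestFunction_mollifier (N := N) n
  ext x
  rw [mollify_apply, ← h.2.2 _ (hρ.comp_sub_left x), (contDiff_mollify h.1 n).laplacian_eq_sum]
  have h1 : ∀ i, partialDeriv i (partialDeriv i (mollify n f)) x =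
      ∫ t, f t * partialDeriv i (partialDeriv i (mollifier N n)) (x - t) := by
    intro i
    rw [mollify, partialDeriv_convolution h.1 hρ,
      partialDeriv_convolution h.1 (hρ.partialDeriv i)]
    exact convolution_lsmul
  simp only [h1]
  rw [← integral_finsetSum]
  · refine integral_congr_ae (Eventually.of_forall fun t => ?_)
    simp only
    rw [(hρ.comp_sub_left x).1.laplacian_eq_sum, Finset.mul_sum]
    refine Finset.sum_congr rfl fun i _ => ?_
    have h2 : partialDeriv i (fun t => mollifier N n (x - t)) =
        fun t => (-1 : ℝ) * partialDeriv i (mollifier N n) (x - t) := by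
      ext s
      rw [partialDeriv_comp_sub_left hρ.1]
      ring
    rw [h2, partialDeriv_mul contDiff_const ((hρ.partialDeriv i).comp_sub_left x).1,
      partialDeriv_comp_sub_left (hρ.partialDeriv i).1]
    simp [partialDeriv]
  · intro i _
    have h3 := ((hρ.partialDeriv i).partialDeriv i).comp_sub_left x
    exact integrable_mul_of_hasCompactSupport h.1 h3.1.continuous h3.2

/-- Mollifications converge weakly against continuous functions with compact support, as the
mollifier is even. -/
theorem tendsto_integral_mollify_mul {h χ : EuclideanSpace ℝ (Fin N) → ℝ}
    (hh : LocallyIntegrable h volume) (hχ : Continuous χ) (hc : HasCompactSupport χ) :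
    Tendsto (fun n => ∫ x, mollify n h x * χ x) atTop (𝓝 (∫ x, h x * χ x)) := by
  set K : Set (EuclideanSpace ℝ (Fin N)) := Metric.cthickening 1 (tsupport χ) with hK
  have hKc : IsCompact K := hc.isCompact.cthickening
  have hKm : MeasurableSet K := hKc.isClosed.measurableSet
  have hout : ∀ t ∉ K, ∀ s, ‖t - s‖ ≤ 1 → χ s = 0 := by
    intro t ht s hs
    by_contra h0
    refine ht (Metric.mem_cthickening_of_dist_le t s 1 _ (subset_tsupport _ h0) ?_)
    rwa [dist_eq_norm]
  obtain ⟨C, hC⟩ := hc.exists_bound_of_continuous hχ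
  have hhK : Integrable (K.indicator h) := (integrable_indicator_iff hKm).2
    (hh.integrableOn_isCompact hKc)
  have hsym : ∀ n, ∫ x, mollify n h x * χ x = ∫ t, h t * mollify n χ t := by
    intro n
    have hρ := isTestFunction_mollifier (N := N) n
    obtain ⟨D, hD⟩ := hρ.2.exists_bound_of_continuous hρ.1.continuous
    have hint : Integrable (Function.uncurry fun x t => h t * mollifier N n (x - t) * χ x)
        (volume.prod volume) := by
      have h1 : Integrable (fun z : EuclideanSpace ℝ (Fin N) × EuclideanSpace ℝ (Fin N) =>
          χ z.1 * K.indicator h z.2) (volume.prod volume) :=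
        (hχ.integrable_of_hasCompactSupport hc).mul_prod hhK
      have hm : AEStronglyMeasurable (fun z : EuclideanSpace ℝ (Fin N) × EuclideanSpace ℝ (Fin N) =>
          mollifier N n (z.1 - z.2)) (volume.prod volume) :=
        (hρ.1.continuous.comp (continuous_fst.sub continuous_snd)).aestronglyMeasurable
      refine (h1.mul_bdd hm (Eventually.of_forall fun z => hD _)).congr
        (Eventually.of_forall fun z => ?_)
      simp only [Function.uncurry]
      by_cases hz : z.2 ∈ K
      · rw [Set.indicator_of_mem hz]
        ring
      · rw [Set.indicator_of_notMem hz]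
        rcases le_or_gt ‖z.1 - z.2‖ 1 with h3 | h3
        · rw [hout _ hz z.1 (by rwa [norm_sub_rev])]
          ring
        · rw [mollifier_eq_zero n h3]
          ring
    calc ∫ x, mollify n h x * χ x
        = ∫ x, ∫ t, h t * mollifier N n (x - t) * χ x := by
          simp only [mollify_apply, integral_mul_const]
      _ = ∫ t, ∫ x, h t * mollifier N n (x - t) * χ x := integral_integral_swap hint
      _ = ∫ t, h t * mollify n χ t := by
          refine integral_congr_ae (Eventually.of_forall fun t => ?_)
          simp only [mollify_apply]
          rw [← integral_const_mul]
          refine integral_congr_ae (Eventually.of_forall fun x => ?_)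
          simp only
          rw [← mollifier_neg n (t - x), neg_sub]
          ring
  simp only [hsym]
  have hχi := hχ.locallyIntegrable (μ := volume)
  refine tendsto_integral_of_dominated_convergence (fun t => ‖K.indicator h t‖ * C)
    (fun n => hh.aestronglyMeasurable.mul (contDiff_mollify hχi n).continuous.aestronglyMeasurable)
    (hhK.norm.mul_const C) (fun n => Eventually.of_forall fun t => ?_)
    (Eventually.of_forall fun t => (tendsto_mollify_of_continuous hχ t).const_mul _)
  rw [norm_mul]
  by_cases ht : t ∈ K
  · rw [Set.indicator_of_mem ht]
    exact mul_le_mul_of_nonneg_left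
      (abs_mollify_le (Eventually.of_forall fun s _ => hC s) n) (norm_nonneg _)
  · have h0 : |mollify n χ t| ≤ 0 :=
      abs_mollify_le (Eventually.of_forall fun s hs => by rw [hout t ht s hs, abs_zero]) n
    rw [Set.indicator_of_notMem ht, Real.norm_eq_abs (mollify n χ t), abs_nonpos_iff.1 h0]
    simp

end Mollification

/-! ### Cutoff functions -/

section Cutoff

open Filter Topology

variable {N : ℕ}

/-- The data of a cutoff at scale `R`: the cutoff is `ψ = η ^ (k + 4)`, and `χ` and `Θ` control its
derivatives through `|∇ψ|² ≤ χ ψ`, `|Δχ| ≤ Θ` and `(Δψ)² ≤ Θ ψ`, where `Θ` lives on `‖x‖ ≥ R` and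
is at most `C ‖x‖⁻⁴ η ^ k` there. The power `k` left in the last bound is what makes it possible to
absorb `Θ` into `ψ` by Young's inequality. -/
structure IsCutoff (k : ℕ) (C R : ℝ) (η χ Θ : EuclideanSpace ℝ (Fin N) → ℝ) : Prop where
  isTestFunction_pow : IsTestFunction fun x => η x ^ (k + 4)
  nonneg : ∀ x, 0 ≤ η x
  le_one : ∀ x, η x ≤ 1
  eq_one : ∀ x, ‖x‖ ≤ R → η x = 1
  isTestFunction_chi : IsTestFunction χ
  chi_nonneg : ∀ x, 0 ≤ χ x
  continuous_theta : Continuous Θ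
  hasCompactSupport_theta : HasCompactSupport Θ
  theta_nonneg : ∀ x, 0 ≤ Θ x
  gradient_sq_le : ∀ x, ∑ i, partialDeriv i (fun y => η y ^ (k + 4)) x ^ 2 ≤ χ x * η x ^ (k + 4)
  abs_laplacian_chi_le : ∀ x, |(Δ χ) x| ≤ Θ x
  laplacian_sq_le : ∀ x, (Δ fun y => η y ^ (k + 4)) x ^ 2 ≤ Θ x * η x ^ (k + 4)
  theta_eq_zero : ∀ x, ‖x‖ < R → Θ x = 0
  theta_le : ∀ x, R ≤ ‖x‖ → Θ x ≤ C / ‖x‖ ^ 4 * η x ^ k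

theorem partialDeriv_eq_zero_of_eventuallyEq {f : EuclideanSpace ℝ (Fin N) → ℝ} {c : ℝ}
    {x : EuclideanSpace ℝ (Fin N)} (h : f =ᶠ[𝓝 x] fun _ => c) (i : Fin N) :
    partialDeriv i f x = 0 := by
  unfold partialDeriv
  rw [h.fderiv_eq]
  simp

theorem laplacian_eq_zero_of_eventuallyEq {f : EuclideanSpace ℝ (Fin N) → ℝ} {c : ℝ}
    {x : EuclideanSpace ℝ (Fin N)} (h : f =ᶠ[𝓝 x] fun _ => c) : (Δ f) x = 0 := by
  rw [(InnerProductSpace.laplacian_congr_nhds h).eq_of_nhds]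
  exact congrFun (InnerProductSpace.laplacian_const (c := c)) x

theorem partialDeriv_comp_smul {f : EuclideanSpace ℝ (Fin N) → ℝ} (hf : ContDiff ℝ ∞ f) (c : ℝ)
    (i : Fin N) (x : EuclideanSpace ℝ (Fin N)) :
    partialDeriv i (fun y => f (c • y)) x = c * partialDeriv i f (c • x) := by
  unfold partialDeriv
  have h := (hf.differentiable (by simp) (c • x)).hasFDerivAt.comp x
    ((hasFDerivAt_id x).const_smul c)
  rw [show (fun y => f (c • y)) = f ∘ (HSMul.hSMul c) from rfl, h.fderiv]
  simp

theorem ContDiff.comp_const_smul {f : EuclideanSpace ℝ (Fin N) → ℝ} (hf : ContDiff ℝ ∞ f)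
    (c : ℝ) : ContDiff ℝ ∞ fun y => f (c • y) :=
  hf.comp (contDiff_const_smul c)

theorem laplacian_comp_smul {f : EuclideanSpace ℝ (Fin N) → ℝ} (hf : ContDiff ℝ ∞ f) (c : ℝ)
    (x : EuclideanSpace ℝ (Fin N)) :
    (Δ fun y => f (c • y)) x = c ^ 2 * (Δ f) (c • x) := by
  rw [(hf.comp_const_smul c).laplacian_eq_sum, hf.laplacian_eq_sum, Finset.mul_sum]
  refine Finset.sum_congr rfl fun i _ => ?_
  rw [show partialDeriv i (fun y => f (c • y)) = fun y => c * partialDeriv i f (c • y) from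
      funext (partialDeriv_comp_smul hf c i),
    partialDeriv_mul contDiff_const ((hf.partialDeriv i).comp_const_smul c),
    partialDeriv_comp_smul (hf.partialDeriv i)]
  simp only [partialDeriv, fderiv_fun_const, Pi.zero_apply, zero_apply]
  ring

theorem laplacian_const_mul {f : EuclideanSpace ℝ (Fin N) → ℝ} (hf : ContDiff ℝ ∞ f) (c : ℝ)
    (x : EuclideanSpace ℝ (Fin N)) : (Δ fun y => c * f y) x = c * (Δ f) x := by
  rw [laplacian_mul_apply contDiff_const hf,
    laplacian_eq_zero_of_eventuallyEq (c := c) Filter.EventuallyEq.rfl]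
  simp [partialDeriv_eq_zero_of_eventuallyEq (c := c) Filter.EventuallyEq.rfl]

theorem partialDeriv_pow {w : EuclideanSpace ℝ (Fin N) → ℝ} (hw : ContDiff ℝ ∞ w) (m : ℕ)
    (i : Fin N) (x : EuclideanSpace ℝ (Fin N)) :
    partialDeriv i (fun y => w y ^ (m + 1)) x = ((m : ℝ) + 1) * w x ^ m * partialDeriv i w x := by
  refine partialDeriv_comp hw (F := fun t => t ^ (m + 1)) i ?_
  simpa using hasDerivAt_pow (m + 1) (w x)

theorem laplacian_pow_mul_apply {w f : EuclideanSpace ℝ (Fin N) → ℝ} (hw : ContDiff ℝ ∞ w)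
    (hf : ContDiff ℝ ∞ f) (k : ℕ) (x : EuclideanSpace ℝ (Fin N)) :
    (Δ fun y => w y ^ (k + 2) * f y) x = w x ^ k *
      ((((k : ℝ) + 2) * w x * (Δ w) x +
        ((k : ℝ) + 2) * ((k : ℝ) + 1) * ∑ i, partialDeriv i w x ^ 2) * f x +
      2 * (((k : ℝ) + 2) * w x * ∑ i, partialDeriv i w x * partialDeriv i f x) +
      w x ^ 2 * (Δ f) x) := by
  rw [laplacian_mul_apply (hw.pow _) hf, laplacian_pow_apply hw k x]
  simp only [partialDeriv_pow hw (k + 1)]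
  rw [show ∑ i, ((k + 1 : ℕ) + 1 : ℝ) * w x ^ (k + 1) * partialDeriv i w x * partialDeriv i f x =
      ((k : ℝ) + 2) * w x ^ (k + 1) * ∑ i, partialDeriv i w x * partialDeriv i f x by
    rw [Finset.mul_sum]
    refine Finset.sum_congr rfl fun i _ => ?_
    push_cast
    ring]
  ring

/-- A cutoff at unit scale; the general case follows by scaling. -/
theorem exists_isCutoff_one (N k : ℕ) :
    ∃ C : ℝ, 0 ≤ C ∧ ∃ η χ Θ : EuclideanSpace ℝ (Fin N) → ℝ, IsTestFunction η ∧
      (∀ x, 0 ≤ η x) ∧ (∀ x, η x ≤ 1) ∧ (∀ x, ‖x‖ ≤ 1 → η x = 1) ∧ (∀ x, 2 ≤ ‖x‖ → η x = 0) ∧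
      IsTestFunction χ ∧ (∀ x, 0 ≤ χ x) ∧
      Continuous Θ ∧ HasCompactSupport Θ ∧ (∀ x, 0 ≤ Θ x) ∧
      (∀ x, ∑ i, partialDeriv i (fun y => η y ^ (k + 4)) x ^ 2 ≤ χ x * η x ^ (k + 4)) ∧
      (∀ x, |(Δ χ) x| ≤ Θ x) ∧
      (∀ x, (Δ fun y => η y ^ (k + 4)) x ^ 2 ≤ Θ x * η x ^ (k + 4)) ∧
      (∀ x, ‖x‖ < 1 → Θ x = 0) ∧ ∀ x, Θ x ≤ C * η x ^ k := by
  obtain ⟨η, hηt, hη0, hηle, hη1, hη2⟩ : ∃ η : EuclideanSpace ℝ (Fin N) → ℝ, IsTestFunction η ∧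
      (∀ x, 0 ≤ η x) ∧ (∀ x, η x ≤ 1) ∧ (∀ x, ‖x‖ ≤ 1 → η x = 1) ∧ ∀ x, 2 ≤ ‖x‖ → η x = 0 := by
    let b : ContDiffBump (0 : EuclideanSpace ℝ (Fin N)) := ⟨1, 2, one_pos, one_lt_two⟩
    exact ⟨b, ⟨b.contDiff, b.hasCompactSupport⟩, fun x => b.nonneg, fun x => b.le_one,
      fun x hx => b.one_of_mem_closedBall (by simpa [b] using hx),
      fun x hx => b.zero_of_le_dist (by simpa [b] using hx)⟩
  obtain ⟨S, hS⟩ : ∃ S : EuclideanSpace ℝ (Fin N) → ℝ,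
      S = fun x => ∑ i, partialDeriv i η x ^ 2 := ⟨_, rfl⟩
  have hSc : ContDiff ℝ ∞ S := hS ▸ ContDiff.sum fun i _ => (hηt.1.partialDeriv i).pow 2
  have hS0 : ∀ x, 0 ≤ S x := fun x => hS ▸ Finset.sum_nonneg fun i _ => sq_nonneg _
  have hev : ∀ x : EuclideanSpace ℝ (Fin N), ‖x‖ < 1 → ∀ᶠ y in 𝓝 x, ‖y‖ < 1 := fun x hx =>
    continuous_norm.continuousAt.eventually_lt continuousAt_const hx
  have hηe : ∀ x, ‖x‖ < 1 → η =ᶠ[𝓝 x] fun _ => 1 := fun x hx =>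
    (hev x hx).mono fun y hy => hη1 y hy.le
  have hSz : ∀ x, ‖x‖ < 1 → S x = 0 := fun x hx => by
    simp [hS, partialDeriv_eq_zero_of_eventuallyEq (hηe x hx)]
  have hSe : ∀ x, ‖x‖ < 1 → S =ᶠ[𝓝 x] fun _ => 0 := fun x hx => (hev x hx).mono hSz
  -- `Δψ = η ^ (k + 2) A` and `Δχ = η ^ k B`
  obtain ⟨A, hA⟩ : ∃ A : EuclideanSpace ℝ (Fin N) → ℝ, A = fun x =>
    ((k : ℝ) + 4) * η x * (Δ η) x + ((k : ℝ) + 4) * ((k : ℝ) + 3) * S x := ⟨_, rfl⟩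
  obtain ⟨B, hB⟩ : ∃ B : EuclideanSpace ℝ (Fin N) → ℝ, B = fun x => ((k : ℝ) + 4) ^ 2 *
    ((((k : ℝ) + 2) * η x * (Δ η) x + ((k : ℝ) + 2) * ((k : ℝ) + 1) * S x) * S x +
      2 * (((k : ℝ) + 2) * η x * ∑ i, partialDeriv i η x * partialDeriv i S x) +
      η x ^ 2 * (Δ S) x) := ⟨_, rfl⟩
  have hAc : Continuous A := hA ▸
    ((continuous_const.mul hηt.1.continuous).mul hηt.1.laplacian.continuous).add
      (continuous_const.mul hSc.continuous)
  have hBc : Continuous B := by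
    rw [hB]
    refine continuous_const.mul (((((continuous_const.mul hηt.1.continuous).mul
      hηt.1.laplacian.continuous).add (continuous_const.mul hSc.continuous)).mul
      hSc.continuous).add (continuous_const.mul ((continuous_const.mul hηt.1.continuous).mul
      (continuous_finsetSum _ fun i _ => ?_))) |>.add
      ((hηt.1.continuous.pow 2).mul hSc.laplacian.continuous))
    exact (hηt.1.partialDeriv i).continuous.mul (hSc.partialDeriv i).continuous
  have hψ : ∀ x, (Δ fun y => η y ^ (k + 4)) x = η x ^ (k + 2) * A x := fun x => by
    rw [laplacian_pow_apply hηt.1 (k + 2) x]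
    simp only [hA, hS]
    push_cast
    ring
  obtain ⟨χ, hχd⟩ : ∃ χ : EuclideanSpace ℝ (Fin N) → ℝ,
      χ = fun x => ((k : ℝ) + 4) ^ 2 * (η x ^ (k + 2) * S x) := ⟨_, rfl⟩
  have hχt : ContDiff ℝ ∞ χ := hχd ▸ contDiff_const.mul ((hηt.1.pow _).mul hSc)
  have hχ : ∀ x, (Δ χ) x = η x ^ k * B x := by
    intro x
    rw [hχd, laplacian_const_mul ((hηt.1.pow _).mul hSc), laplacian_pow_mul_apply hηt.1 hSc]
    simp only [hB, hS]
    ring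
  have hsupp : ∀ x, x ∉ tsupport η → A x = 0 ∧ B x = 0 := by
    intro x hx
    have h1 : η =ᶠ[𝓝 x] fun _ => 0 := notMem_tsupport_iff_eventuallyEq.1 hx
    have h2 : S =ᶠ[𝓝 x] fun _ => 0 := by
      filter_upwards [h1.eventuallyEq_nhds] with y hy
      simp [hS, partialDeriv_eq_zero_of_eventuallyEq hy]
    simp [hA, hB, h1.eq_of_nhds, h2.eq_of_nhds]
  have hABs : HasCompactSupport fun x => A x ^ 2 + |B x| := by
    refine HasCompactSupport.intro hηt.2 fun x hx => ?_
    simp [hsupp x hx]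
  obtain ⟨C, hC⟩ := hABs.exists_bound_of_continuous ((hAc.pow 2).add hBc.abs)
  have hAB0 : ∀ x, 0 ≤ A x ^ 2 + |B x| := fun x => by positivity
  obtain ⟨Θ, hΘ⟩ : ∃ Θ : EuclideanSpace ℝ (Fin N) → ℝ,
      Θ = fun x => η x ^ k * (A x ^ 2 + |B x|) := ⟨_, rfl⟩
  have hχs : HasCompactSupport χ := HasCompactSupport.intro hηt.2 fun x hx => by
    simp [hχd, image_eq_zero_of_notMem_tsupport hx]
  have hχ0 : ∀ x, 0 ≤ χ x := fun x => by
    have := hη0 x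
    have := hS0 x
    rw [hχd]
    positivity
  have hΘc : Continuous Θ := by
    rw [hΘ]
    exact (hηt.1.continuous.pow _).mul ((hAc.pow 2).add hBc.abs)
  have hΘs : HasCompactSupport Θ := hΘ ▸ hABs.mul_left
  have hΘ0 : ∀ x, 0 ≤ Θ x := fun x => by
    rw [hΘ]
    exact mul_nonneg (pow_nonneg (hη0 x) _) (hAB0 x)
  have hgrad : ∀ x, ∑ i, partialDeriv i (fun y => η y ^ (k + 4)) x ^ 2 ≤ χ x * η x ^ (k + 4) := by
    intro x
    simp only [partialDeriv_pow hηt.1 (k + 3), hχd, hS, mul_pow, ← Finset.mul_sum]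
    apply le_of_eq
    push_cast
    ring
  have hlapχ : ∀ x, |(Δ χ) x| ≤ Θ x := fun x => by
    rw [hχ, hΘ, abs_mul, abs_of_nonneg (pow_nonneg (hη0 x) k)]
    exact mul_le_mul_of_nonneg_left (by linarith [sq_nonneg (A x)]) (pow_nonneg (hη0 x) k)
  have hlap : ∀ x, (Δ fun y => η y ^ (k + 4)) x ^ 2 ≤ Θ x * η x ^ (k + 4) := fun x => by
    have h0 := hη0 x
    rw [hψ, hΘ]
    have : 0 ≤ η x ^ k * |B x| * η x ^ (k + 4) := by positivity
    calc (η x ^ (k + 2) * A x) ^ 2 = η x ^ k * A x ^ 2 * η x ^ (k + 4) := by ring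
      _ ≤ η x ^ k * A x ^ 2 * η x ^ (k + 4) + η x ^ k * |B x| * η x ^ (k + 4) := by linarith
      _ = _ := by ring
  have hz : ∀ x, ‖x‖ < 1 → Θ x = 0 := fun x hx => by
    have h1 := laplacian_eq_zero_of_eventuallyEq (hηe x hx)
    have h2 := laplacian_eq_zero_of_eventuallyEq (hSe x hx)
    have h3 := partialDeriv_eq_zero_of_eventuallyEq (hηe x hx)
    have h4 := hSz x hx
    simp only [hΘ, hA, hB, h1, h2, h3, h4]
    simp
  have hle : ∀ x, Θ x ≤ C * η x ^ k := fun x => by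
    rw [hΘ, mul_comm C]
    exact mul_le_mul_of_nonneg_left ((le_abs_self _).trans (hC x)) (pow_nonneg (hη0 x) _)
  exact ⟨C, (norm_nonneg _).trans (hC 0), η, χ, Θ, hηt, hη0, hηle, hη1, hη2, ⟨hχt, hχs⟩, hχ0, hΘc,
    hΘs, hΘ0, hgrad, hlapχ, hlap, hz, hle⟩

theorem exists_isCutoff (N : ℕ) {k : ℕ} (hk : k ≠ 0) :
    ∃ C : ℝ, 0 ≤ C ∧ ∀ R : ℝ, 0 < R →
      ∃ η χ Θ : EuclideanSpace ℝ (Fin N) → ℝ, IsCutoff k C R η χ Θ := by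
  obtain ⟨C, hC0, η, χ, Θ, hη, hη0, hη1, hη2, hη3, hχ, hχ0, hΘc, hΘs, hΘ0, h1, h2, h3, h4, h5⟩ :=
    exists_isCutoff_one N k
  refine ⟨16 * C, by positivity, fun R hR => ?_⟩
  have hR' : R⁻¹ ≠ 0 := inv_ne_zero hR.ne'
  have hn : ∀ x : EuclideanSpace ℝ (Fin N), ‖R⁻¹ • x‖ = ‖x‖ / R := fun x => by
    rw [norm_smul, Real.norm_of_nonneg (by positivity), inv_mul_eq_div]
  have hsupp : ∀ f : EuclideanSpace ℝ (Fin N) → ℝ, HasCompactSupport f →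
      HasCompactSupport fun x => f (R⁻¹ • x) := fun f hf =>
    hf.comp_homeomorph (Homeomorph.smulOfNeZero R⁻¹ hR')
  have hψ : ContDiff ℝ ∞ fun y => η y ^ (k + 4) := hη.1.pow _
  have hψs : HasCompactSupport fun y => η y ^ (k + 4) :=
    hη.2.comp_left (g := fun t => t ^ (k + 4)) (by simp)
  have hp : ∀ m : ℕ, 0 < R⁻¹ ^ m := fun m => by positivity
  refine ⟨fun x => η (R⁻¹ • x), fun x => R⁻¹ ^ 2 * χ (R⁻¹ • x), fun x => R⁻¹ ^ 4 * Θ (R⁻¹ • x), ?_⟩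
  have hgrad : ∀ x, ∑ i, partialDeriv i (fun y => η (R⁻¹ • y) ^ (k + 4)) x ^ 2 ≤
      R⁻¹ ^ 2 * χ (R⁻¹ • x) * η (R⁻¹ • x) ^ (k + 4) := fun x => by
    simp only [partialDeriv_comp_smul hψ, mul_pow, ← Finset.mul_sum]
    rw [mul_assoc]
    exact mul_le_mul_of_nonneg_left (h1 _) (hp 2).le
  have hlapχ : ∀ x, |(Δ fun y => R⁻¹ ^ 2 * χ (R⁻¹ • y)) x| ≤ R⁻¹ ^ 4 * Θ (R⁻¹ • x) := fun x => by
    rw [laplacian_const_mul (hχ.1.comp_const_smul R⁻¹), laplacian_comp_smul hχ.1]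
    rw [← mul_assoc, ← pow_add, abs_mul, abs_of_pos (hp _)]
    exact mul_le_mul_of_nonneg_left (h2 _) (hp _).le
  have hlap : ∀ x, (Δ fun y => η (R⁻¹ • y) ^ (k + 4)) x ^ 2 ≤
      R⁻¹ ^ 4 * Θ (R⁻¹ • x) * η (R⁻¹ • x) ^ (k + 4) := fun x => by
    rw [laplacian_comp_smul hψ, mul_pow, ← pow_mul, mul_assoc]
    exact mul_le_mul_of_nonneg_left (h3 _) (hp _).le
  have htheta : ∀ x, R ≤ ‖x‖ →
      R⁻¹ ^ 4 * Θ (R⁻¹ • x) ≤ 16 * C / ‖x‖ ^ 4 * η (R⁻¹ • x) ^ k := fun x hx => by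
    have hx0 : 0 < ‖x‖ := hR.trans_le hx
    rcases le_or_gt 2 ‖R⁻¹ • x‖ with h6 | h6
    · have h7 := h5 (R⁻¹ • x)
      rw [hη3 _ h6, zero_pow hk, mul_zero] at h7
      simp only [hη3 _ h6, zero_pow hk, mul_zero]
      exact mul_nonpos_of_nonneg_of_nonpos (hp 4).le h7
    · have h7 : R⁻¹ ^ 4 ≤ 16 / ‖x‖ ^ 4 := by
        rw [hn, div_lt_iff₀ hR] at h6
        rw [inv_pow, inv_eq_one_div, div_le_div_iff₀ (by positivity) (by positivity)]
        calc 1 * ‖x‖ ^ 4 ≤ 1 * (2 * R) ^ 4 := by gcongr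
          _ = 16 * R ^ 4 := by ring
      calc R⁻¹ ^ 4 * Θ (R⁻¹ • x) ≤ 16 / ‖x‖ ^ 4 * (C * η (R⁻¹ • x) ^ k) :=
            mul_le_mul h7 (h5 _) (hΘ0 _) (by positivity)
        _ = _ := by ring
  exact
  { isTestFunction_pow := ⟨hψ.comp_const_smul R⁻¹, hsupp _ hψs⟩
    nonneg := fun x => hη0 _
    le_one := fun x => hη1 _
    eq_one := fun x hx => hη2 _ (by rw [hn]; exact (div_le_one hR).2 hx)
    isTestFunction_chi :=
      ⟨contDiff_const.mul (hχ.1.comp_const_smul R⁻¹), (hsupp _ hχ.2).mul_left⟩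
    chi_nonneg := fun x => mul_nonneg (hp 2).le (hχ0 _)
    continuous_theta := continuous_const.mul (hΘc.comp (continuous_const_smul R⁻¹))
    hasCompactSupport_theta := (hsupp _ hΘs).mul_left
    theta_nonneg := fun x => mul_nonneg (hp 4).le (hΘ0 _)
    gradient_sq_le := hgrad
    abs_laplacian_chi_le := hlapχ
    laplacian_sq_le := hlap
    theta_eq_zero := fun x hx => by
      rw [h4 _ (by rw [hn]; exact (div_lt_one hR).2 hx), mul_zero]
    theta_le := htheta }

end Cutoff

/-! ### The energy inequality for smooth approximations -/

section SmoothEnergy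

variable {N : ℕ}

theorem two_mul_abs_le_add_of_sq_le_mul {p x y : ℝ} (hx : 0 ≤ x) (hy : 0 ≤ y)
    (h : p ^ 2 ≤ x * y) : 2 * |p| ≤ x + y := by
  refine abs_le_of_sq_le_sq' ?_ (by positivity) |>.2
  rw [mul_pow, sq_abs]
  nlinarith [sq_nonneg (x - y)]

theorem integral_le_add_add_add {X : Type*} [MeasurableSpace X] {μ : Measure X}
    {f f₀ f₁ f₂ f₃ : X → ℝ} {c₁ c₂ c₃ : ℝ} (hf : Integrable f μ) (h₀ : Integrable f₀ μ)
    (h₁ : Integrable f₁ μ) (h₂ : Integrable f₂ μ) (h₃ : Integrable f₃ μ)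
    (h : ∀ x, f x ≤ f₀ x + c₁ * f₁ x + c₂ * f₂ x + c₃ * f₃ x) :
    ∫ x, f x ∂μ ≤ ∫ x, f₀ x ∂μ + c₁ * ∫ x, f₁ x ∂μ + c₂ * ∫ x, f₂ x ∂μ + c₃ * ∫ x, f₃ x ∂μ := by
  have e1 : Integrable (fun x => f₀ x + c₁ * f₁ x) μ := h₀.add (h₁.const_mul c₁)
  have e2 : Integrable (fun x => f₀ x + c₁ * f₁ x + c₂ * f₂ x) μ := e1.add (h₂.const_mul c₂)
  refine (integral_mono hf (e2.add (h₃.const_mul c₃)) h).trans_eq ?_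
  rw [← integral_const_mul, ← integral_const_mul, ← integral_const_mul,
    ← integral_add h₀ (h₁.const_mul c₁), ← integral_add e1 (h₂.const_mul c₂),
    ← integral_add e2 (h₃.const_mul c₃)]
  rfl

/-- A Caccioppoli inequality: for `w` positive and subharmonic, `w ^ (α + 1)` is subharmonic with
`Δ(w ^ (α + 1)) ≥ α w ^ (α - 1) |∇w|²`, and the Laplacian is moved to the cutoff `χ`. -/
theorem integral_rpow_mul_gradient_sq_le {w χ Θ : EuclideanSpace ℝ (Fin N) → ℝ} {α : ℝ}
    (hα : 0 < α) (hw : ContDiff ℝ ∞ w) (hpos : ∀ x, 0 < w x) (hΔ : ∀ x, 0 ≤ (Δ w) x)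
    (hχ : IsTestFunction χ) (hχ0 : ∀ x, 0 ≤ χ x) (hΘ : Continuous Θ) (hΘs : HasCompactSupport Θ)
    (hχΘ : ∀ x, |(Δ χ) x| ≤ Θ x) :
    ∫ x, α * w x ^ (α - 1) * (∑ i, partialDeriv i w x ^ 2) * χ x ≤ ∫ x, w x ^ (α + 1) * Θ x := by
  have hne : ∀ x, w x ≠ 0 := fun x => (hpos x).ne'
  have hS : Continuous fun x => ∑ i, partialDeriv i w x ^ 2 :=
    continuous_finsetSum _ fun i _ => (hw.partialDeriv i).continuous.pow 2
  have hwc : ∀ β : ℝ, ContDiff ℝ ∞ fun x => w x ^ β := fun β => hw.rpow_const_of_ne hne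
  calc ∫ x, α * w x ^ (α - 1) * (∑ i, partialDeriv i w x ^ 2) * χ x
      ≤ ∫ x, (Δ fun y => w y ^ (α + 1)) x * χ x := by
        refine integral_mono ?_ ?_ fun x => ?_
        · exact (((continuous_const.mul (hwc _).continuous).mul hS).mul
            hχ.1.continuous).integrable_of_hasCompactSupport hχ.2.mul_left
        · exact ((hwc _).laplacian.continuous.mul
            hχ.1.continuous).integrable_of_hasCompactSupport hχ.2.mul_left
        · refine mul_le_mul_of_nonneg_right ?_ (hχ0 x)
          simp only
          rw [laplacian_rpow_apply hw hpos, show α + 1 - 1 = α by ring,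
            show α + 1 - 2 = α - 1 by ring]
          have h1 : 0 ≤ w x ^ α * (Δ w) x :=
            mul_nonneg (Real.rpow_nonneg (hpos x).le _) (hΔ x)
          have h2 : 0 ≤ w x ^ (α - 1) * ∑ i, partialDeriv i w x ^ 2 :=
            mul_nonneg (Real.rpow_nonneg (hpos x).le _) (Finset.sum_nonneg fun i _ => sq_nonneg _)
          nlinarith [mul_nonneg hα.le h1, mul_nonneg (mul_nonneg hα.le hα.le) h2]
    _ = ∫ x, w x ^ (α + 1) * (Δ χ) x := (integral_mul_laplacian (hwc _) hχ).symm
    _ ≤ ∫ x, w x ^ (α + 1) * Θ x := by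
        refine integral_mono ?_ ?_ fun x => ?_
        · exact ((hwc _).continuous.mul
            hχ.laplacian.1.continuous).integrable_of_hasCompactSupport hχ.laplacian.2.mul_left
        · exact ((hwc _).continuous.mul hΘ).integrable_of_hasCompactSupport hΘs.mul_left
        · exact mul_le_mul_of_nonneg_left ((le_abs_self _).trans (hχΘ x))
            (Real.rpow_nonneg (hpos x).le _)

/-- Testing a distributional inequality `h ≤ -ΔL + f` with `w ^ α ψ`, for a smooth positive
subharmonic `w` and a cutoff `ψ`. The terms with derivatives of `ψ` are bounded by a small multiple
of `∫ L² w ^ (α - 1) ψ` and a large multiple of `∫ w ^ (α + 1) Θ`. -/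
theorem energy_inequality_of_smooth {h f L w η χ Θ : EuclideanSpace ℝ (Fin N) → ℝ} {k : ℕ}
    {C R α δ : ℝ} (hα : 0 < α) (hδ : 0 < δ)
    (hL : LocallyIntegrable L volume) (hL2 : LocallyIntegrable (fun x => L x ^ 2) volume)
    (hineq : ∀ φ : EuclideanSpace ℝ (Fin N) → ℝ, IsTestFunction φ → (∀ x, 0 ≤ φ x) →
      ∫ x, h x * φ x ≤ -(∫ x, L x * (Δ φ) x) + ∫ x, f x * φ x)
    (hw : ContDiff ℝ ∞ w) (hpos : ∀ x, 0 < w x) (hΔ : ∀ x, 0 ≤ (Δ w) x)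
    (hc : IsCutoff k C R η χ Θ) :
    ∫ x, L x * ((Δ fun y => w y ^ α) x * η x ^ (k + 4)) ≤
      (∫ x, f x * (w x ^ α * η x ^ (k + 4))) +
      δ * (α + 1) * (∫ x, L x ^ 2 * (w x ^ (α - 1) * η x ^ (k + 4))) +
      2 / δ * (∫ x, w x ^ (α + 1) * Θ x) - ∫ x, h x * (w x ^ α * η x ^ (k + 4)) := by
  have hne : ∀ x, w x ≠ 0 := fun x => (hpos x).ne'
  have hwc : ∀ β : ℝ, ContDiff ℝ ∞ fun x => w x ^ β := fun β => hw.rpow_const_of_ne hne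
  obtain ⟨ψ, hψ⟩ : ∃ ψ : EuclideanSpace ℝ (Fin N) → ℝ, ψ = fun x => η x ^ (k + 4) := ⟨_, rfl⟩
  have hψx : ∀ x, η x ^ (k + 4) = ψ x := fun x => by rw [hψ]
  have hψt : IsTestFunction ψ := hψ ▸ hc.isTestFunction_pow
  have hψ0 : ∀ x, 0 ≤ ψ x := fun x => hψ ▸ pow_nonneg (hc.nonneg x) _
  have hgrad : ∀ x, ∑ i, partialDeriv i ψ x ^ 2 ≤ χ x * ψ x := hψ ▸ hc.gradient_sq_le
  have hlap : ∀ x, (Δ ψ) x ^ 2 ≤ Θ x * ψ x := hψ ▸ hc.laplacian_sq_le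
  simp only [hψx]
  have hφt : IsTestFunction fun x => w x ^ α * ψ x := ⟨(hwc α).mul hψt.1, hψt.2.mul_left⟩
  have hS : Continuous fun x => ∑ i, partialDeriv i w x ^ 2 :=
    continuous_finsetSum _ fun i _ => (hw.partialDeriv i).continuous.pow 2
  have key := hineq _ hφt fun x => mul_nonneg (Real.rpow_nonneg (hpos x).le _) (hψ0 x)
  have cacc := integral_rpow_mul_gradient_sq_le hα hw hpos hΔ hc.isTestFunction_chi hc.chi_nonneg
    hc.continuous_theta hc.hasCompactSupport_theta hc.abs_laplacian_chi_le
  have i1 : Integrable fun x => L x * (Δ fun y => w y ^ α * ψ y) x :=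
    integrable_mul_of_hasCompactSupport hL hφt.laplacian.1.continuous hφt.laplacian.2
  have i2 : Integrable fun x => L x ^ 2 * (w x ^ (α - 1) * ψ x) :=
    integrable_mul_of_hasCompactSupport hL2 ((hwc _).continuous.mul hψt.1.continuous) hψt.2.mul_left
  have i3 : Integrable fun x => α * w x ^ (α - 1) * (∑ i, partialDeriv i w x ^ 2) * χ x :=
    (((continuous_const.mul (hwc _).continuous).mul hS).mul
      hc.isTestFunction_chi.1.continuous).integrable_of_hasCompactSupport
      hc.isTestFunction_chi.2.mul_left
  have i4 : Integrable fun x => w x ^ (α + 1) * Θ x :=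
    ((hwc _).continuous.mul hc.continuous_theta).integrable_of_hasCompactSupport
      hc.hasCompactSupport_theta.mul_left
  have i5 : Integrable fun x => L x * ((Δ fun y => w y ^ α) x * ψ x) :=
    integrable_mul_of_hasCompactSupport hL ((hwc _).laplacian.continuous.mul hψt.1.continuous)
      hψt.2.mul_left
  have hpt : ∀ x, L x * ((Δ fun y => w y ^ α) x * ψ x) ≤
      L x * (Δ fun y => w y ^ α * ψ y) x + δ * (α + 1) * (L x ^ 2 * (w x ^ (α - 1) * ψ x)) +
        δ⁻¹ * (α * w x ^ (α - 1) * (∑ i, partialDeriv i w x ^ 2) * χ x) +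
          δ⁻¹ * (w x ^ (α + 1) * Θ x) := by
    intro x
    have hW : 0 ≤ w x ^ (α - 1) := Real.rpow_nonneg (hpos x).le _
    have e1 : w x ^ α = w x ^ (α - 1) * w x := by
      rw [← Real.rpow_add_one (hne x), sub_add_cancel]
    have e2 : w x ^ (α + 1) = w x ^ (α - 1) * w x ^ 2 := by
      rw [Real.rpow_add_one (hne x), e1]
      ring
    have hpd : ∀ i, partialDeriv i (fun y => w y ^ α) x =
        α * w x ^ (α - 1) * partialDeriv i w x := fun i =>
      partialDeriv_comp hw (F := fun t => t ^ α) i (Real.hasDerivAt_rpow_const (Or.inl (hne x)))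
    set P := ∑ i, partialDeriv i w x * partialDeriv i ψ x with hP
    set S := ∑ i, partialDeriv i w x ^ 2 with hSdef
    have hS0 : 0 ≤ S := Finset.sum_nonneg fun i _ => sq_nonneg _
    have hsum : ∑ i, partialDeriv i (fun y => w y ^ α) x * partialDeriv i ψ x =
        α * w x ^ (α - 1) * P := by
      rw [hP, Finset.mul_sum]
      refine Finset.sum_congr rfl fun i _ => ?_
      rw [hpd]
      ring
    have hP2 : P ^ 2 ≤ S * (χ x * ψ x) :=
      (Finset.sum_mul_sq_le_sq_mul_sq _ _ _).trans (mul_le_mul_of_nonneg_left (hgrad x) hS0)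
    have hL0 := sq_nonneg (L x)
    have y1 : 2 * |L x * P| ≤ δ * (L x ^ 2 * ψ x) + δ⁻¹ * (S * χ x) := by
      refine two_mul_abs_le_add_of_sq_le_mul
        (mul_nonneg hδ.le (mul_nonneg hL0 (hψ0 x)))
        (mul_nonneg (by positivity) (mul_nonneg hS0 (hc.chi_nonneg x))) ?_
      calc (L x * P) ^ 2 = L x ^ 2 * P ^ 2 := by ring
        _ ≤ L x ^ 2 * (S * (χ x * ψ x)) := mul_le_mul_of_nonneg_left hP2 hL0
        _ = _ := by field_simp
    have y2 : 2 * |L x * w x * (Δ ψ) x| ≤ δ * (L x ^ 2 * ψ x) + δ⁻¹ * (w x ^ 2 * Θ x) := by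
      refine two_mul_abs_le_add_of_sq_le_mul
        (mul_nonneg hδ.le (mul_nonneg hL0 (hψ0 x)))
        (mul_nonneg (by positivity) (mul_nonneg (sq_nonneg _) (hc.theta_nonneg x))) ?_
      calc (L x * w x * (Δ ψ) x) ^ 2 = L x ^ 2 * w x ^ 2 * (Δ ψ) x ^ 2 := by ring
        _ ≤ L x ^ 2 * w x ^ 2 * (Θ x * ψ x) :=
          mul_le_mul_of_nonneg_left (hlap x) (mul_nonneg hL0 (sq_nonneg _))
        _ = _ := by field_simp
    have z1 := mul_le_mul_of_nonneg_left (neg_abs_le (L x * P))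
      (mul_nonneg (mul_nonneg zero_le_two hα.le) hW)
    have z2 := mul_le_mul_of_nonneg_left (neg_abs_le (L x * w x * (Δ ψ) x)) hW
    have z3 := mul_le_mul_of_nonneg_left y1 (mul_nonneg hα.le hW)
    have z4 := mul_le_mul_of_nonneg_left y2 hW
    have z5 := mul_nonneg hW (abs_nonneg (L x * w x * (Δ ψ) x))
    -- expand `Δ(w ^ α ψ)` and factor `w ^ (α - 1)` out of the two terms with derivatives of `ψ`
    rw [laplacian_mul_apply (hwc α) hψt.1, hsum, e1, e2]
    linarith
  have hint := integral_le_add_add_add i5 i1 i2 i3 i4 hpt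
  have := mul_le_mul_of_nonneg_left cacc (inv_nonneg.2 hδ.le)
  rw [div_eq_mul_inv]
  linarith

end SmoothEnergy

/-! ### Smooth subharmonic approximation of a Sobolev function -/

section Approximation

open Filter Topology

variable {N : ℕ}

theorem MemLpLoc.locallyIntegrable {f : EuclideanSpace ℝ (Fin N) → ℝ} {p : ℝ≥0∞}
    (hf : MemLpLoc f p) (hp : 1 ≤ p) : LocallyIntegrable f volume := by
  rw [locallyIntegrable_iff]
  intro K hK
  have : IsFiniteMeasure (volume.restrict K) := ⟨by simpa using hK.measure_lt_top⟩
  exact (hf K hK).integrable hp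

theorem MemLpLoc.locallyIntegrable_sq {f : EuclideanSpace ℝ (Fin N) → ℝ} (hf : MemLpLoc f 2) :
    LocallyIntegrable (fun x => f x ^ 2) volume :=
  locallyIntegrable_iff.2 fun K hK => (hf K hK).integrable_sq

theorem MemLpLoc.exists_ae_bound {f : EuclideanSpace ℝ (Fin N) → ℝ} (hf : MemLpLoc f ∞)
    {K : Set (EuclideanSpace ℝ (Fin N))} (hK : IsCompact K) :
    ∃ M : ℝ, 0 ≤ M ∧ ∀ᵐ x, x ∈ K → |f x| ≤ M := by
  have h1 := (hf K hK).2
  rw [eLpNorm_exponent_top] at h1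
  refine ⟨(eLpNormEssSup f (volume.restrict K)).toReal, ENNReal.toReal_nonneg, ?_⟩
  have h2 := ae_le_eLpNormEssSup (f := f) (μ := volume.restrict K)
  rw [ae_restrict_iff' hK.isClosed.measurableSet] at h2
  filter_upwards [h2] with x hx hxK
  have h3 := ENNReal.toReal_mono h1.ne (hx hxK)
  rwa [toReal_enorm, Real.norm_eq_abs] at h3

/-- A product of a locally bounded and a locally integrable function is locally integrable. -/
theorem locallyIntegrable_mul_of_locally_bounded {f g : EuclideanSpace ℝ (Fin N) → ℝ}
    (hf : AEStronglyMeasurable f volume)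
    (hb : ∀ K : Set (EuclideanSpace ℝ (Fin N)), IsCompact K → ∃ M : ℝ, ∀ᵐ x, x ∈ K → |f x| ≤ M)
    (hg : LocallyIntegrable g volume) : LocallyIntegrable (fun x => f x * g x) volume := by
  rw [locallyIntegrable_iff] at hg ⊢
  intro K hK
  obtain ⟨M, hM⟩ := hb K hK
  refine (hg K hK).bdd_mul hf.restrict (c := M) ?_
  rw [ae_restrict_iff' hK.isClosed.measurableSet]
  exact hM

theorem MemLpLoc.locallyIntegrable_rpow_mul {u f : EuclideanSpace ℝ (Fin N) → ℝ} {β : ℝ}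
    (hu : MemLpLoc u ∞) (hu0 : ∀ᵐ x, 0 ≤ u x) (hβ : 0 ≤ β) (hf : LocallyIntegrable f volume) :
    LocallyIntegrable (fun x => u x ^ β * f x) volume := by
  have hum : AEMeasurable u volume :=
    (hu.locallyIntegrable le_top).aestronglyMeasurable.aemeasurable
  refine locallyIntegrable_mul_of_locally_bounded
    (hum.pow_const β).aestronglyMeasurable (fun K hK => ?_) hf
  obtain ⟨M, -, hM⟩ := hu.exists_ae_bound hK
  refine ⟨M ^ β, ?_⟩
  filter_upwards [hM, hu0] with x hx h0 hxK
  rw [abs_of_nonneg (Real.rpow_nonneg h0 _)]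
  exact Real.rpow_le_rpow h0 ((le_abs_self _).trans (hx hxK)) hβ

/-- A sequence of smooth positive subharmonic functions `w n` that converges to `u` almost
everywhere together with its gradient (to `G`) and its Laplacian (to `L`), is locally uniformly
bounded, and for which `Δ(w n)` and `|∇(w n)|²` are dominated by functions `D n` that converge both
almost everywhere and as measures. -/
structure IsSmoothApprox (u L : EuclideanSpace ℝ (Fin N) → ℝ)
    (G : Fin N → EuclideanSpace ℝ (Fin N) → ℝ) (w D : ℕ → EuclideanSpace ℝ (Fin N) → ℝ) :
    Prop where
  contDiff : ∀ n, ContDiff ℝ ∞ (w n)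
  pos : ∀ n x, 0 < w n x
  laplacian_nonneg : ∀ n x, 0 ≤ (Δ (w n)) x
  tendsto : ∀ᵐ x, Tendsto (fun n => w n x) atTop (𝓝 (u x))
  tendsto_partialDeriv : ∀ᵐ x, ∀ i, Tendsto (fun n => partialDeriv i (w n) x) atTop (𝓝 (G i x))
  tendsto_laplacian : ∀ᵐ x, Tendsto (fun n => (Δ (w n)) x) atTop (𝓝 (L x))
  bounded : ∀ K : Set (EuclideanSpace ℝ (Fin N)), IsCompact K → ∃ M : ℝ, ∀ n, ∀ x ∈ K, w n x ≤ M
  continuous_dominating : ∀ n, Continuous (D n)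
  laplacian_le : ∀ n x, (Δ (w n)) x ≤ D n x
  gradient_sq_le : ∀ n x, ∑ i, partialDeriv i (w n) x ^ 2 ≤ D n x
  tendsto_dominating : ∀ᵐ x, Tendsto (fun n => D n x) atTop (𝓝 (L x + ∑ i, G i x ^ 2))
  tendsto_integral_dominating : ∀ χ : EuclideanSpace ℝ (Fin N) → ℝ, Continuous χ →
    HasCompactSupport χ → Tendsto (fun n => ∫ x, D n x * χ x) atTop
      (𝓝 (∫ x, (L x + ∑ i, G i x ^ 2) * χ x))

/-- Mollification, with a small constant added for positivity. -/
theorem exists_isSmoothApprox {u L : EuclideanSpace ℝ (Fin N) → ℝ}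
    {G : Fin N → EuclideanSpace ℝ (Fin N) → ℝ} (hu0 : ∀ᵐ x, 0 ≤ u x) (hu : MemLpLoc u ∞)
    (hL : HasWeakLaplacian u L) (hL0 : ∀ᵐ x, 0 ≤ L x) (hG : ∀ i, HasWeakPartial i u (G i))
    (hG2 : ∀ i, LocallyIntegrable (fun x => G i x ^ 2) volume) :
    ∃ w D, IsSmoothApprox u L G w D := by
  have hmol := fun n => contDiff_mollify hL.1 n
  have hpd : ∀ n i, partialDeriv i (fun x => mollify n u x + 1 / ((n : ℝ) + 1)) =
      mollify n (G i) := fun n i => by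
    ext x
    rw [partialDeriv_add (hmol n) contDiff_const,
      partialDeriv_eq_zero_of_eventuallyEq (c := 1 / ((n : ℝ) + 1)) EventuallyEq.rfl, add_zero,
      partialDeriv_mollify (hG i)]
  have hlap : ∀ n, (Δ fun x => mollify n u x + 1 / ((n : ℝ) + 1)) = mollify n L := fun n => by
    ext x
    rw [((hmol n).add contDiff_const).laplacian_eq_sum, ← laplacian_mollify hL,
      (hmol n).laplacian_eq_sum]
    simp only [hpd, partialDeriv_mollify (hG _)]
  have hn1 : ∀ n : ℕ, 1 / ((n : ℝ) + 1) ≤ 1 := fun n => by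
    rw [div_le_one (by positivity)]
    linarith [(Nat.cast_nonneg n : (0 : ℝ) ≤ n)]
  have hGall : ∀ᵐ x, ∀ i, Tendsto (fun n => mollify n (G i) x) atTop (𝓝 (G i x)) :=
    ae_all_iff.2 fun i => ae_tendsto_mollify (hG i).2.1
  have hG2all : ∀ᵐ x, ∀ i, Tendsto (fun n => mollify n (fun y => G i y ^ 2) x) atTop
      (𝓝 (G i x ^ 2)) := ae_all_iff.2 fun i => ae_tendsto_mollify (hG2 i)
  have hG2nn : ∀ n i x, 0 ≤ mollify n (fun y => G i y ^ 2) x := fun n i x =>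
    mollify_nonneg (Eventually.of_forall fun y => sq_nonneg _) n x
  have hLc : ∀ n, Continuous (mollify n L) := fun n => (contDiff_mollify hL.2.1 n).continuous
  have hG2c : ∀ n i, Continuous (mollify n fun y => G i y ^ 2) := fun n i =>
    (contDiff_mollify (hG2 i) n).continuous
  refine ⟨fun n x => mollify n u x + 1 / ((n : ℝ) + 1),
    fun n x => mollify n L x + ∑ i, mollify n (fun y => G i y ^ 2) x, ?_⟩
  exact
  { contDiff := fun n => (hmol n).add contDiff_const
    pos := fun n x => add_pos_of_nonneg_of_pos (mollify_nonneg hu0 n x) (by positivity)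
    laplacian_nonneg := fun n x => by
      rw [hlap]
      exact mollify_nonneg hL0 n x
    tendsto := by
      filter_upwards [ae_tendsto_mollify hL.1] with x hx
      simpa using hx.add tendsto_one_div_add_atTop_nhds_zero_nat
    tendsto_partialDeriv := by simpa only [hpd] using hGall
    tendsto_laplacian := by simpa only [hlap] using ae_tendsto_mollify hL.2.1
    bounded := fun K hK => by
      obtain ⟨M, -, hM⟩ := hu.exists_ae_bound (hK.cthickening (r := 1))
      refine ⟨M + 1, fun n x hx => add_le_add ((le_abs_self _).trans (abs_mollify_le ?_ n)) (hn1 n)⟩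
      filter_upwards [hM] with t ht hxt
      refine ht (Metric.mem_cthickening_of_dist_le t x 1 K hx ?_)
      rwa [dist_eq_norm, norm_sub_rev]
    continuous_dominating := fun n => (hLc n).add (continuous_finsetSum _ fun i _ => hG2c n i)
    laplacian_le := fun n x => by
      rw [hlap]
      exact le_add_of_nonneg_right (Finset.sum_nonneg fun i _ => hG2nn n i x)
    gradient_sq_le := fun n x => by
      simp only [hpd]
      exact (Finset.sum_le_sum fun i _ => mollify_sq_le (hG i).2.1 (hG2 i) n x).trans
        (le_add_of_nonneg_left (mollify_nonneg hL0 n x))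
    tendsto_dominating := by
      filter_upwards [ae_tendsto_mollify hL.2.1, hG2all] with x h1 h2
      exact h1.add (tendsto_finsetSum _ fun i _ => h2 i)
    tendsto_integral_dominating := fun χ hχ hc => by
      simp only [add_mul, Finset.sum_mul]
      have h1 : ∀ n, Integrable fun x => mollify n L x * χ x := fun n =>
        ((hLc n).mul hχ).integrable_of_hasCompactSupport hc.mul_left
      have h2 : ∀ n i, Integrable fun x => mollify n (fun y => G i y ^ 2) x * χ x := fun n i =>
        ((hG2c n i).mul hχ).integrable_of_hasCompactSupport hc.mul_left
      have h3 : Integrable fun x => L x * χ x := integrable_mul_of_hasCompactSupport hL.2.1 hχ hc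
      have h4 : ∀ i, Integrable fun x => G i x ^ 2 * χ x := fun i =>
        integrable_mul_of_hasCompactSupport (hG2 i) hχ hc
      rw [integral_add h3 (integrable_finsetSum _ fun i _ => h4 i),
        integral_finsetSum _ fun i _ => h4 i]
      refine Tendsto.congr (fun n => ?_) ((tendsto_integral_mollify_mul hL.2.1 hχ hc).add
        (tendsto_finsetSum _ fun i _ => tendsto_integral_mollify_mul (hG2 i) hχ hc))
      rw [integral_add (h1 n) (integrable_finsetSum _ fun i _ => h2 n i),
        integral_finsetSum _ fun i _ => h2 n i] }

variable {u L : EuclideanSpace ℝ (Fin N) → ℝ} {G : Fin N → EuclideanSpace ℝ (Fin N) → ℝ}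
  {w D : ℕ → EuclideanSpace ℝ (Fin N) → ℝ}

theorem IsSmoothApprox.exists_rpow_le (hw : IsSmoothApprox u L G w D)
    {K : Set (EuclideanSpace ℝ (Fin N))} (hK : IsCompact K) {β : ℝ} (hβ : 0 ≤ β) :
    ∃ M : ℝ, 0 ≤ M ∧ ∀ n, ∀ x ∈ K, w n x ^ β ≤ M := by
  obtain ⟨M, hM⟩ := hw.bounded K hK
  refine ⟨|M| ^ β, by positivity, fun n x hx => ?_⟩
  exact Real.rpow_le_rpow (hw.pos n x).le ((hM n x hx).trans (le_abs_self M)) hβ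

theorem IsSmoothApprox.contDiff_rpow (hw : IsSmoothApprox u L G w D) (n : ℕ) (β : ℝ) :
    ContDiff ℝ ∞ fun x => w n x ^ β :=
  (hw.contDiff n).rpow_const_of_ne fun x => (hw.pos n x).ne'

theorem IsSmoothApprox.tendsto_integral_mul_rpow (hw : IsSmoothApprox u L G w D)
    {h ζ : EuclideanSpace ℝ (Fin N) → ℝ} (hh : LocallyIntegrable h volume) (hζ : Continuous ζ)
    (hc : HasCompactSupport ζ) {β : ℝ} (hβ : 0 ≤ β) :
    Tendsto (fun n => ∫ x, h x * (w n x ^ β * ζ x)) atTop (𝓝 (∫ x, h x * (u x ^ β * ζ x))) := by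
  obtain ⟨M, hM0, hM⟩ := hw.exists_rpow_le hc.isCompact hβ
  have hi := (integrable_mul_of_hasCompactSupport hh hζ hc).norm.const_mul M
  refine tendsto_integral_of_dominated_convergence _ (fun n => hh.aestronglyMeasurable.mul
    ((hw.contDiff_rpow n β).continuous.mul hζ).aestronglyMeasurable) hi
    (fun n => Eventually.of_forall fun x => ?_) ?_
  · by_cases hx : x ∈ tsupport ζ
    · have h1 : 0 ≤ w n x ^ β := Real.rpow_nonneg (hw.pos n x).le _
      calc ‖h x * (w n x ^ β * ζ x)‖ = w n x ^ β * ‖h x * ζ x‖ := by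
            rw [norm_mul, norm_mul, norm_mul, Real.norm_of_nonneg h1]
            ring
        _ ≤ M * ‖h x * ζ x‖ := mul_le_mul_of_nonneg_right (hM n x hx) (norm_nonneg _)
    · simp [image_eq_zero_of_notMem_tsupport hx]
  · filter_upwards [hw.tendsto] with x hx
    exact ((hx.rpow_const (Or.inr hβ)).mul_const _).const_mul _

/-- The pointwise expression `α u ^ (α - 1) Δu + α (α - 1) u ^ (α - 2) |∇u|²` of `Δ(u ^ α)`. -/
noncomputable def rpowLaplacian (α : ℝ) (u L : EuclideanSpace ℝ (Fin N) → ℝ)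
    (G : Fin N → EuclideanSpace ℝ (Fin N) → ℝ) (x : EuclideanSpace ℝ (Fin N)) : ℝ :=
  α * u x ^ (α - 1) * L x + α * (α - 1) * u x ^ (α - 2) * ∑ i, G i x ^ 2

theorem IsSmoothApprox.tendsto_laplacian_rpow (hw : IsSmoothApprox u L G w D) {α : ℝ}
    (hα : 2 ≤ α) :
    ∀ᵐ x, Tendsto (fun n => (Δ fun y => w n y ^ α) x) atTop (𝓝 (rpowLaplacian α u L G x)) := by
  filter_upwards [hw.tendsto, hw.tendsto_partialDeriv, hw.tendsto_laplacian] with x h1 h2 h3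
  simp only [laplacian_rpow_apply (hw.contDiff _) (hw.pos _)]
  exact (((h1.rpow_const (Or.inr (by linarith))).const_mul _).mul h3).add
    (((h1.rpow_const (Or.inr (by linarith))).const_mul _).mul
      (tendsto_finsetSum _ fun i _ => (h2 i).pow 2))

theorem IsSmoothApprox.laplacian_rpow_nonneg (hw : IsSmoothApprox u L G w D) {α : ℝ}
    (hα : 1 ≤ α) (n : ℕ) (x : EuclideanSpace ℝ (Fin N)) : 0 ≤ (Δ fun y => w n y ^ α) x := by
  rw [laplacian_rpow_apply (hw.contDiff n) (hw.pos n)]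
  have h1 := hw.laplacian_nonneg n x
  have h2 : 0 ≤ ∑ i, partialDeriv i (w n) x ^ 2 := Finset.sum_nonneg fun i _ => sq_nonneg _
  have h3 := hw.pos n x
  have h4 : 0 ≤ α - 1 := by linarith
  have h5 : 0 ≤ α := by linarith
  positivity

/-- The chain rule for the weak Laplacian of `u ^ α`. -/
theorem IsSmoothApprox.hasWeakLaplacian_rpow (hw : IsSmoothApprox u L G w D) {α : ℝ} (hα : 2 ≤ α)
    (hu0 : ∀ᵐ x, 0 ≤ u x) (hu : MemLpLoc u ∞) (hL : LocallyIntegrable L volume)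
    (hG2 : ∀ i, LocallyIntegrable (fun x => G i x ^ 2) volume) :
    HasWeakLaplacian (fun x => u x ^ α) (rpowLaplacian α u L G) := by
  have hloc : ∀ {β : ℝ} {f : EuclideanSpace ℝ (Fin N) → ℝ}, 0 ≤ β → LocallyIntegrable f volume →
      LocallyIntegrable (fun x => u x ^ β * f x) volume := fun hβ hf =>
    hu.locallyIntegrable_rpow_mul hu0 hβ hf
  refine ⟨?_, ?_, fun φ hφ => ?_⟩
  · simpa using hloc (by linarith : 0 ≤ α)
      (continuous_const (y := (1 : ℝ))).locallyIntegrable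
  · have h1 := (hloc (by linarith : 0 ≤ α - 1) hL).smul α
    have h2 := (hloc (by linarith : 0 ≤ α - 2)
      (locallyIntegrable_finsetSum Finset.univ fun i _ => hG2 i)).smul (α * (α - 1))
    suffices e : rpowLaplacian α u L G = (α • fun x => u x ^ (α - 1) * L x) +
        (α * (α - 1)) • fun x => u x ^ (α - 2) * ∑ i, G i x ^ 2 by
      rw [e]
      exact h1.add h2
    ext x
    simp only [rpowLaplacian, Pi.add_apply, Pi.smul_apply, smul_eq_mul]
    ring
  · have hKc := hφ.2.isCompact
    obtain ⟨M₁, hM₁, hb₁⟩ := hw.exists_rpow_le hKc (by linarith : 0 ≤ α - 1)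
    obtain ⟨M₂, hM₂, hb₂⟩ := hw.exists_rpow_le hKc (by linarith : 0 ≤ α - 2)
    -- `c` bounds the coefficients of `Δ(w n)` and `|∇(w n)|²` on the support of `φ`
    set c := α * M₁ + α * (α - 1) * M₂ with hc
    have hα0 : 0 ≤ α := by linarith
    have hα1 : 0 ≤ α - 1 := by linarith
    have hlim1 : Tendsto (fun n => ∫ x, w n x ^ α * (Δ φ) x) atTop
        (𝓝 (∫ x, u x ^ α * (Δ φ) x)) := by
      simpa using hw.tendsto_integral_mul_rpow (h := fun _ => 1)
        (continuous_const (y := (1 : ℝ))).locallyIntegrable hφ.laplacian.1.continuous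
        hφ.laplacian.2 hα0
    have hDi : LocallyIntegrable (fun x => L x + ∑ i, G i x ^ 2) volume :=
      hL.add (locallyIntegrable_finsetSum Finset.univ fun i _ => hG2 i)
    have hφa : HasCompactSupport fun x => |φ x| := hφ.2.abs
    have hlim2 : Tendsto (fun n => ∫ x, (Δ fun y => w n y ^ α) x * φ x) atTop
        (𝓝 (∫ x, rpowLaplacian α u L G x * φ x)) := by
      refine tendsto_integral_of_tendsto_dominating (G := fun n x => c * (D n x * |φ x|))
        (g := fun x => c * ((L x + ∑ i, G i x ^ 2) * |φ x|)) (fun n => ?_) (fun n => ?_) ?_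
        (fun n => Eventually.of_forall fun x => ?_) ?_ ?_ ?_
      · exact ((hw.contDiff_rpow n α).laplacian.continuous.mul
          hφ.1.continuous).aestronglyMeasurable
      · exact (((hw.continuous_dominating n).mul
          hφ.1.continuous.abs).integrable_of_hasCompactSupport hφa.mul_left).const_mul c
      · exact (integrable_mul_of_hasCompactSupport hDi hφ.1.continuous.abs hφa).const_mul c
      · by_cases hx : x ∈ tsupport φ
        · rw [abs_mul, abs_of_nonneg (hw.laplacian_rpow_nonneg (by linarith) n x), ← mul_assoc]
          refine mul_le_mul_of_nonneg_right ?_ (abs_nonneg _)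
          rw [laplacian_rpow_apply (hw.contDiff n) (hw.pos n), hc, add_mul]
          refine add_le_add ?_ ?_
          · exact mul_le_mul (mul_le_mul_of_nonneg_left (hb₁ n x hx) hα0) (hw.laplacian_le n x)
              (hw.laplacian_nonneg n x) (mul_nonneg hα0 hM₁)
          · exact mul_le_mul (mul_le_mul_of_nonneg_left (hb₂ n x hx) (mul_nonneg hα0 hα1))
              (hw.gradient_sq_le n x) (Finset.sum_nonneg fun i _ => sq_nonneg _)
              (mul_nonneg (mul_nonneg hα0 hα1) hM₂)
        · simp [image_eq_zero_of_notMem_tsupport hx]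
      · filter_upwards [hw.tendsto_laplacian_rpow hα] with x hx
        exact hx.mul_const _
      · filter_upwards [hw.tendsto_dominating] with x hx
        exact (hx.mul_const _).const_mul _
      · simp only [integral_const_mul]
        exact (hw.tendsto_integral_dominating _ hφ.1.continuous.abs hφa).const_mul c
    refine tendsto_nhds_unique hlim1 (hlim2.congr fun n => ?_)
    exact (integral_mul_laplacian (hw.contDiff_rpow n α) hφ).symm

/-- The energy inequality for `u` itself. The term containing `Δu |∇u|²` is only controlled from
below, by Fatou's lemma, which is why no bound of `∇u` in `L⁴` is needed. -/
theorem IsSmoothApprox.energy_inequality (hw : IsSmoothApprox u L G w D)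
    {h f η χ Θ : EuclideanSpace ℝ (Fin N) → ℝ} {k : ℕ}
    {C R α δ : ℝ} (hα : 2 ≤ α) (hδ : 0 < δ)
    (hL : LocallyIntegrable L volume) (hL2 : LocallyIntegrable (fun x => L x ^ 2) volume)
    (hL0 : ∀ᵐ x, 0 ≤ L x)
    (hh : LocallyIntegrable h volume) (hf : LocallyIntegrable f volume)
    (hineq : ∀ φ : EuclideanSpace ℝ (Fin N) → ℝ, IsTestFunction φ → (∀ x, 0 ≤ φ x) →
      ∫ x, h x * φ x ≤ -(∫ x, L x * (Δ φ) x) + ∫ x, f x * φ x)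
    (hc : IsCutoff k C R η χ Θ) :
    Integrable (fun x => L x * (rpowLaplacian α u L G x * η x ^ (k + 4))) ∧
    ∫ x, L x * (rpowLaplacian α u L G x * η x ^ (k + 4)) ≤
      (∫ x, f x * (u x ^ α * η x ^ (k + 4))) +
      δ * (α + 1) * (∫ x, L x ^ 2 * (u x ^ (α - 1) * η x ^ (k + 4))) +
      2 / δ * (∫ x, u x ^ (α + 1) * Θ x) - ∫ x, h x * (u x ^ α * η x ^ (k + 4)) := by
  have hψ := hc.isTestFunction_pow
  have hα0 : 0 < α := by linarith
  refine integrable_and_integral_le_of_tendsto (fun n => ?_) (fun n => ?_) ?_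
    (fun n => energy_inequality_of_smooth hα0 hδ hL hL2 hineq (hw.contDiff n) (hw.pos n)
      (hw.laplacian_nonneg n) hc) ?_
  · exact integrable_mul_of_hasCompactSupport hL
      ((hw.contDiff_rpow n α).laplacian.continuous.mul hψ.1.continuous) hψ.2.mul_left
  · filter_upwards [hL0] with x hx
    exact mul_nonneg hx (mul_nonneg (hw.laplacian_rpow_nonneg (by linarith) n x)
      (pow_nonneg (hc.nonneg x) _))
  · filter_upwards [hw.tendsto_laplacian_rpow hα] with x hx
    exact (hx.mul_const _).const_mul _
  · have h1 := hw.tendsto_integral_mul_rpow (h := fun _ => 1)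
      (continuous_const (y := (1 : ℝ))).locallyIntegrable hc.continuous_theta
      hc.hasCompactSupport_theta (by linarith : 0 ≤ α + 1)
    simp only [one_mul] at h1
    exact (((hw.tendsto_integral_mul_rpow hf hψ.1.continuous hψ.2 hα0.le).add
      ((hw.tendsto_integral_mul_rpow hL2 hψ.1.continuous hψ.2
        (by linarith : 0 ≤ α - 1)).const_mul _)).add (h1.const_mul _)).sub
      (hw.tendsto_integral_mul_rpow hh hψ.1.continuous hψ.2 hα0.le)

end Approximation

/-! ### Absorption by Young's inequality -/

section Young

theorem mul_le_mul_rpow_add_rpow_mul_rpow {p p' B c T : ℝ} (hp : p.HolderConjugate p') (hB : 0 < B)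
    (hc : 0 ≤ c) (hT : 0 ≤ T) : c * T ≤ B * T ^ p + c ^ p' * B ^ (1 - p') := by
  have hp0 := hp.pos
  have hp'0 := hp.symm.pos
  have hb : 0 < B ^ (1 / p) := Real.rpow_pos_of_pos hB _
  have h := Real.young_inequality_of_nonneg (mul_nonneg hb.le hT) (div_nonneg hc hb.le) hp
  have e1 : B ^ (1 / p) * T * (c / B ^ (1 / p)) = c * T := by
    field_simp
  have e2 : (B ^ (1 / p) * T) ^ p = B * T ^ p := by
    rw [Real.mul_rpow hb.le hT, ← Real.rpow_mul hB.le, one_div_mul_cancel hp0.ne', Real.rpow_one]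
  have e3 : (c / B ^ (1 / p)) ^ p' = c ^ p' * B ^ (1 - p') := by
    have h1 : 1 / p * p' = p' - 1 := by
      have h2 := hp.inv_add_inv_eq_one
      have : 1 / p = 1 - p'⁻¹ := by rw [one_div]; linarith
      rw [this, sub_mul, inv_mul_cancel₀ hp'0.ne', one_mul]
    rw [Real.div_rpow hc hb.le, ← Real.rpow_mul hB.le, h1, div_eq_mul_inv, ← Real.rpow_neg hB.le,
      neg_sub]
  rw [e1, e2, e3] at h
  have h3 : 0 ≤ B * T ^ p := by positivity
  have h4 : 0 ≤ c ^ p' * B ^ (1 - p') := by positivity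
  exact h.trans (add_le_add (div_le_self h3 hp.lt.le) (div_le_self h4 hp.symm.lt.le))

/-- Young's inequality with exponents `(q + α) / (α + 1)` and `p' = (q + α) / (q - 1)`, weighted so
that the term `t ^ (q + α)` carries the weight `r ^ (-θ) e ^ (k + 4)`. The remainder is a power of
`r` with the exponent `(4 - θ) p' + θ`. -/
theorem exists_young_weighted {α q θ A ε : ℝ} {k : ℕ} (hα : 0 < α) (hq : 1 < q)
    (hθ0 : 0 ≤ θ) (hθ4 : θ ≤ 4)
    (hk : k ≠ 0) (hk4 : 4 * ((q + α) / (q - 1)) ≤ k + 4) (hA : 0 ≤ A) (hε : 0 < ε) :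
    ∃ K : ℝ, 0 ≤ K ∧ ∀ t r e : ℝ, 0 ≤ t → 1 ≤ r → 0 ≤ e → e ≤ 1 →
      A / r ^ 4 * e ^ k * t ^ (α + 1) ≤
        ε / r ^ θ * e ^ (k + 4) * t ^ (q + α) +
          K * (1 + r) ^ (-((4 - θ) * ((q + α) / (q - 1)) + θ)) := by
  set p' := (q + α) / (q - 1) with hp'
  have hq1 : 0 < q - 1 := by linarith
  have hqα : 0 < q + α := by linarith
  have hα1 : 0 < α + 1 := by linarith
  have hconj : ((q + α) / (α + 1)).HolderConjugate p' := by
    rw [Real.holderConjugate_iff]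
    refine ⟨by rw [lt_div_iff₀ hα1]; linarith, ?_⟩
    rw [hp', inv_div, inv_div]
    field_simp
    ring
  have hp'0 : 0 < p' := hconj.symm.pos
  set s := (4 - θ) * p' + θ with hs
  have hs0 : 0 ≤ s := add_nonneg (mul_nonneg (by linarith) hp'0.le) hθ0
  refine ⟨A ^ p' * ε ^ (1 - p') * 2 ^ s, by positivity, fun t r e ht hr he0 he1 => ?_⟩
  have hr0 : 0 < r := by linarith
  have hrem : 0 ≤ A ^ p' * ε ^ (1 - p') * 2 ^ s * (1 + r) ^ (-s) := by positivity
  rcases he0.eq_or_lt with rfl | he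
  · have h1 : 0 ≤ ε / r ^ θ * 0 ^ (k + 4) * t ^ (q + α) := by positivity
    rw [zero_pow hk, mul_zero, zero_mul]
    linarith
  have hB : 0 < ε / r ^ θ * e ^ (k + 4) := by positivity
  have hc : 0 ≤ A / r ^ 4 * e ^ k := by positivity
  have hy := mul_le_mul_rpow_add_rpow_mul_rpow hconj hB hc (Real.rpow_nonneg ht (α + 1))
  rw [← Real.rpow_mul ht, mul_div_cancel₀ _ hα1.ne'] at hy
  refine hy.trans (add_le_add le_rfl ?_)
  have e1 : (A / r ^ 4 * e ^ k) ^ p' = A ^ p' * r ^ (-(4 * p')) * e ^ (k * p') := by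
    rw [Real.mul_rpow (by positivity) (by positivity), Real.div_rpow hA (by positivity),
      ← Real.rpow_natCast r 4, ← Real.rpow_natCast e k, ← Real.rpow_mul hr0.le,
      ← Real.rpow_mul he.le, Real.rpow_neg hr0.le, div_eq_mul_inv]
    norm_num
  have e2 : (ε / r ^ θ * e ^ (k + 4)) ^ (1 - p') =
      ε ^ (1 - p') * r ^ (-(θ * (1 - p'))) * e ^ ((k + 4) * (1 - p')) := by
    rw [Real.mul_rpow (by positivity) (by positivity), Real.div_rpow hε.le (by positivity),
      ← Real.rpow_natCast e (k + 4), ← Real.rpow_mul hr0.le,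
      ← Real.rpow_mul he.le, Real.rpow_neg hr0.le, div_eq_mul_inv]
    push_cast
    rfl
  have e3 : r ^ (-(4 * p')) * r ^ (-(θ * (1 - p'))) = r ^ (-s) := by
    rw [← Real.rpow_add hr0, hs]
    congr 1
    ring
  have e4 : e ^ (k * p') * e ^ ((k + 4) * (1 - p')) ≤ 1 := by
    rw [← Real.rpow_add he]
    exact Real.rpow_le_one he.le he1 (by linarith)
  have e5 : r ^ (-s) ≤ 2 ^ s * (1 + r) ^ (-s) := by
    rw [Real.rpow_neg hr0.le, Real.rpow_neg (by linarith), ← div_eq_mul_inv,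
      ← Real.div_rpow zero_le_two (by linarith), ← Real.inv_rpow hr0.le]
    refine Real.rpow_le_rpow (by positivity) ?_ hs0
    rw [inv_eq_one_div, div_le_div_iff₀ hr0 (by linarith)]
    linarith
  calc (A / r ^ 4 * e ^ k) ^ p' * (ε / r ^ θ * e ^ (k + 4)) ^ (1 - p')
      = A ^ p' * ε ^ (1 - p') * (r ^ (-(4 * p')) * r ^ (-(θ * (1 - p')))) *
          (e ^ (k * p') * e ^ ((k + 4) * (1 - p'))) := by
        rw [e1, e2]
        ring
    _ ≤ A ^ p' * ε ^ (1 - p') * r ^ (-s) * 1 := by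
        rw [e3]
        exact mul_le_mul_of_nonneg_left e4 (by positivity)
    _ ≤ A ^ p' * ε ^ (1 - p') * (2 ^ s * (1 + r) ^ (-s)) * 1 := by gcongr
    _ = _ := by ring

end Young

section Absorption

open Filter Topology

variable {N : ℕ} {u L : EuclideanSpace ℝ (Fin N) → ℝ}
  {G : Fin N → EuclideanSpace ℝ (Fin N) → ℝ} {w D : ℕ → EuclideanSpace ℝ (Fin N) → ℝ}

/-- A lower bound for `Δu Δ(u ^ α)`; the gradient part is nonnegative as `Δu ≥ 0`. -/
theorem mul_sq_le_mul_rpowLaplacian {α : ℝ} (hα : 1 ≤ α) {x : EuclideanSpace ℝ (Fin N)}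
    (hu : 0 ≤ u x) (hL : 0 ≤ L x) :
    α * (L x ^ 2 * u x ^ (α - 1)) ≤ L x * rpowLaplacian α u L G x := by
  have h1 : 0 ≤ L x * (α * (α - 1) * u x ^ (α - 2) * ∑ i, G i x ^ 2) :=
    mul_nonneg hL (mul_nonneg (mul_nonneg (mul_nonneg (by linarith) (by linarith))
      (Real.rpow_nonneg hu _)) (Finset.sum_nonneg fun i _ => sq_nonneg _))
  unfold rpowLaplacian
  nlinarith

/-- The energy inequality on a cutoff region, with the error terms absorbed up to the tail of an
integrable function `τ`. Here `P`, `Q` stand for `a u ^ (q + α)` and `V u ^ (α + 1)`. -/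
theorem IsSmoothApprox.absorbed_energy_inequality (hw : IsSmoothApprox u L G w D)
    {h f P Q τ η χ Θ : EuclideanSpace ℝ (Fin N) → ℝ} {k : ℕ} {C R α δ lam K : ℝ}
    (hα : 2 ≤ α) (hδ : 0 < δ) (hu0 : ∀ᵐ x, 0 ≤ u x)
    (hL : LocallyIntegrable L volume) (hL2 : LocallyIntegrable (fun x => L x ^ 2) volume)
    (hL0 : ∀ᵐ x, 0 ≤ L x)
    (hh : LocallyIntegrable h volume) (hf : LocallyIntegrable f volume)
    (hineq : ∀ φ : EuclideanSpace ℝ (Fin N) → ℝ, IsTestFunction φ → (∀ x, 0 ≤ φ x) →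
      ∫ x, h x * φ x ≤ -(∫ x, L x * (Δ φ) x) + ∫ x, f x * φ x)
    (hP : LocallyIntegrable P volume) (hP0 : ∀ᵐ x, 0 ≤ P x)
    (hhP : ∀ᵐ x, h x * u x ^ α = P x) (hfQ : ∀ᵐ x, f x * u x ^ α = lam * Q x)
    (hτ : Integrable τ)
    (hc : IsCutoff k C R η χ Θ)
    (hyoung : ∀ᵐ x, R ≤ ‖x‖ → 2 / δ * (C / ‖x‖ ^ 4) * η x ^ k * u x ^ (α + 1) ≤
      δ * (P x * η x ^ (k + 4)) + K * τ x) :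
    Integrable (fun x => L x * rpowLaplacian α u L G x * η x ^ (k + 4)) ∧
    (1 - δ) * (∫ x, P x * η x ^ (k + 4)) +
      (1 - 2 * δ) * (∫ x, L x * rpowLaplacian α u L G x * η x ^ (k + 4)) ≤
      lam * (∫ x, Q x * η x ^ (k + 4)) + K * ∫ x, {x | R ≤ ‖x‖}.indicator τ x := by
  have hψ := hc.isTestFunction_pow
  have hψ0 : ∀ x, 0 ≤ η x ^ (k + 4) := fun x => pow_nonneg (hc.nonneg x) _
  obtain ⟨hint, hen⟩ := hw.energy_inequality hα hδ hL hL2 hL0 hh hf hineq hc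
  simp only [← mul_assoc] at hint
  refine ⟨hint, ?_⟩
  have e1 : ∫ x, h x * (u x ^ α * η x ^ (k + 4)) = ∫ x, P x * η x ^ (k + 4) :=
    integral_congr_ae (hhP.mono fun x hx => by simp only [← mul_assoc, hx])
  have e2 : ∫ x, f x * (u x ^ α * η x ^ (k + 4)) = lam * ∫ x, Q x * η x ^ (k + 4) := by
    rw [← integral_const_mul]
    exact integral_congr_ae (hfQ.mono fun x hx => by simp only [← mul_assoc, hx])
  have e3 : ∫ x, L x * (rpowLaplacian α u L G x * η x ^ (k + 4)) =
      ∫ x, L x * rpowLaplacian α u L G x * η x ^ (k + 4) := by simp only [mul_assoc]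
  have hb1 : (α + 1) * ∫ x, L x ^ 2 * (u x ^ (α - 1) * η x ^ (k + 4)) ≤
      2 * ∫ x, L x * rpowLaplacian α u L G x * η x ^ (k + 4) := by
    rw [← integral_const_mul, ← integral_const_mul]
    refine integral_mono_of_nonneg ?_ (hint.const_mul 2) ?_
    · filter_upwards [hu0] with x hx
      have := hψ0 x
      have : 0 ≤ α + 1 := by linarith
      simp only [Pi.zero_apply]
      positivity
    · filter_upwards [hu0, hL0] with x hx hLx
      have h1 := mul_le_mul_of_nonneg_right
        (mul_sq_le_mul_rpowLaplacian (G := G) (by linarith : 1 ≤ α) hx hLx) (hψ0 x)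
      have h2 : 0 ≤ L x ^ 2 * u x ^ (α - 1) * η x ^ (k + 4) :=
        mul_nonneg (mul_nonneg (sq_nonneg _) (Real.rpow_nonneg hx _)) (hψ0 x)
      nlinarith
  have hPi : Integrable fun x => P x * η x ^ (k + 4) :=
    integrable_mul_of_hasCompactSupport hP hψ.1.continuous hψ.2
  have hτi : Integrable ({x : EuclideanSpace ℝ (Fin N) | R ≤ ‖x‖}.indicator τ) :=
    hτ.indicator (measurableSet_le measurable_const measurable_norm)
  have hb2 : 2 / δ * ∫ x, u x ^ (α + 1) * Θ x ≤
      δ * (∫ x, P x * η x ^ (k + 4)) + K * ∫ x, {x | R ≤ ‖x‖}.indicator τ x := by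
    rw [← integral_const_mul, ← integral_const_mul, ← integral_const_mul,
      ← integral_add (hPi.const_mul δ) (hτi.const_mul K)]
    refine integral_mono_of_nonneg ?_ ((hPi.const_mul δ).add (hτi.const_mul K)) ?_
    · filter_upwards [hu0] with x hx
      exact mul_nonneg (by positivity) (mul_nonneg (Real.rpow_nonneg hx _) (hc.theta_nonneg x))
    · filter_upwards [hu0, hP0, hyoung] with x hx hPx hy
      by_cases hR : R ≤ ‖x‖
      · rw [Set.indicator_of_mem (show x ∈ {x | R ≤ ‖x‖} from hR)]
        refine le_trans ?_ (hy hR)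
        have h1 := mul_le_mul_of_nonneg_left (hc.theta_le x hR)
          (mul_nonneg (by positivity : 0 ≤ 2 / δ) (Real.rpow_nonneg hx (α + 1)))
        linarith
      · rw [Set.indicator_of_notMem (show x ∉ {x | R ≤ ‖x‖} from hR),
          hc.theta_eq_zero x (not_le.1 hR), mul_zero, mul_zero, mul_zero, add_zero]
        exact mul_nonneg hδ.le (mul_nonneg hPx (hψ0 x))
  rw [e1, e2, e3] at hen
  have := mul_le_mul_of_nonneg_left hb1 hδ.le
  linarith

end Absorption

/-! ### Removing the cutoff -/

section Global

open Filter Topology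

/-- Passage to the limit in cutoffs `ψ n → 1`. The inequality with `δ = 1 / 4` together with
`lam * Q ≤ P / 4 + H` bounds the integrals of `P ψ` and `Y ψ`; once `P`, `Q`, `Y` are known to be
integrable, `n → ∞` and then `δ → 0` give the conclusion. -/
theorem integrable_and_add_le_of_cutoff {X : Type*} [MeasurableSpace X] {μ : Measure X}
    {P Q Y H : X → ℝ} {ψ : ℕ → X → ℝ} {T : ℕ → ℝ} {lam : ℝ} (hlam : 0 < lam)
    (hP0 : ∀ᵐ x ∂μ, 0 ≤ P x) (hQ0 : ∀ᵐ x ∂μ, 0 ≤ Q x) (hY0 : ∀ᵐ x ∂μ, 0 ≤ Y x)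
    (hQm : AEStronglyMeasurable Q μ) (hψ0 : ∀ n x, 0 ≤ ψ n x) (hψ1 : ∀ n x, ψ n x ≤ 1)
    (hψ : ∀ x, Tendsto (fun n => ψ n x) atTop (𝓝 1))
    (hP : ∀ n, Integrable (fun x => P x * ψ n x) μ) (hQ : ∀ n, Integrable (fun x => Q x * ψ n x) μ)
    (hY : ∀ n, Integrable (fun x => Y x * ψ n x) μ)
    (hH : Integrable H μ) (hQP : ∀ᵐ x ∂μ, lam * Q x ≤ 1 / 4 * P x + H x)
    (hH0 : ∀ᵐ x ∂μ, 0 ≤ H x) (hT : Tendsto T atTop (𝓝 0))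
    (h : ∀ δ : ℝ, 0 < δ → ∃ K : ℝ, ∀ n, (1 - δ) * (∫ x, P x * ψ n x ∂μ) +
      (1 - 2 * δ) * (∫ x, Y x * ψ n x ∂μ) ≤ lam * (∫ x, Q x * ψ n x ∂μ) + K * T n) :
    Integrable P μ ∧ Integrable Q μ ∧ Integrable Y μ ∧
      ∫ x, P x ∂μ + ∫ x, Y x ∂μ ≤ lam * ∫ x, Q x ∂μ := by
  obtain ⟨K, hK⟩ := h (1 / 4) (by norm_num)
  have hPn : ∀ n, 0 ≤ ∫ x, P x * ψ n x ∂μ := fun n => integral_nonneg_of_ae <| by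
    filter_upwards [hP0] with x hx using mul_nonneg hx (hψ0 n x)
  have hYn : ∀ n, 0 ≤ ∫ x, Y x * ψ n x ∂μ := fun n => integral_nonneg_of_ae <| by
    filter_upwards [hY0] with x hx using mul_nonneg hx (hψ0 n x)
  have hQn : ∀ n, lam * ∫ x, Q x * ψ n x ∂μ ≤
      1 / 4 * (∫ x, P x * ψ n x ∂μ) + ∫ x, H x ∂μ := fun n => by
    rw [← integral_const_mul, ← integral_const_mul, ← integral_add ((hP n).const_mul _) hH]
    refine integral_mono_ae ((hQ n).const_mul _) (((hP n).const_mul _).add hH) ?_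
    filter_upwards [hQP, hH0] with x h1 h2
    have h3 := mul_le_mul_of_nonneg_right h1 (hψ0 n x)
    have h4 := mul_le_mul_of_nonneg_left (hψ1 n x) h2
    linarith
  have hbd : Tendsto (fun n => 2 * (∫ x, H x ∂μ + K * T n)) atTop (𝓝 (2 * ∫ x, H x ∂μ)) := by
    simpa using ((hT.const_mul K).const_add (∫ x, H x ∂μ)).const_mul 2
  have hlim : ∀ F : X → ℝ, ∀ x, Tendsto (fun n => F x * ψ n x) atTop (𝓝 (F x)) := fun F x => by
    simpa using (hψ x).const_mul (F x)
  have hPi : Integrable P μ := by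
    refine (integrable_and_integral_le_of_tendsto hP (fun n => ?_)
      (Eventually.of_forall (hlim P)) (fun n => ?_) hbd).1
    · filter_upwards [hP0] with x hx using mul_nonneg hx (hψ0 n x)
    · linarith [hK n, hQn n, hPn n, hYn n]
  have hYi : Integrable Y μ := by
    refine (integrable_and_integral_le_of_tendsto hY (fun n => ?_)
      (Eventually.of_forall (hlim Y)) (fun n => ?_) hbd).1
    · filter_upwards [hY0] with x hx using mul_nonneg hx (hψ0 n x)
    · linarith [hK n, hQn n, hPn n, hYn n]
  have hQi : Integrable Q μ := by
    have hi : Integrable (fun x => lam⁻¹ * (1 / 4 * P x + H x)) μ :=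
      ((hPi.const_mul _).add hH).const_mul _
    refine hi.mono' hQm ?_
    filter_upwards [hQP, hQ0] with x h1 h2
    rw [Real.norm_of_nonneg h2, le_inv_mul_iff₀ hlam]
    exact h1
  have hdom : ∀ F : X → ℝ, Integrable F μ → (∀ n, Integrable (fun x => F x * ψ n x) μ) →
      Tendsto (fun n => ∫ x, F x * ψ n x ∂μ) atTop (𝓝 (∫ x, F x ∂μ)) := fun F hF hFn =>
    tendsto_integral_of_dominated_convergence (fun x => ‖F x‖) (fun n => (hFn n).1) hF.norm
      (fun n => Eventually.of_forall fun x => by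
        rw [norm_mul, Real.norm_of_nonneg (hψ0 n x)]
        exact mul_le_of_le_one_right (norm_nonneg _) (hψ1 n x))
      (Eventually.of_forall (hlim F))
  refine ⟨hPi, hQi, hYi, ?_⟩
  have hδ : ∀ δ : ℝ, 0 < δ → (1 - δ) * (∫ x, P x ∂μ) + (1 - 2 * δ) * (∫ x, Y x ∂μ) ≤
      lam * ∫ x, Q x ∂μ := fun δ hδ => by
    obtain ⟨K', hK'⟩ := h δ hδ
    have hr := ((hdom Q hQi hQ).const_mul lam).add (hT.const_mul K')
    rw [mul_zero, add_zero] at hr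
    exact le_of_tendsto_of_tendsto' (((hdom P hPi hP).const_mul _).add
      ((hdom Y hYi hY).const_mul _)) hr hK'
  have hc : Tendsto (fun δ : ℝ => (1 - δ) * (∫ x, P x ∂μ) + (1 - 2 * δ) * (∫ x, Y x ∂μ))
      (𝓝[>] 0) (𝓝 (∫ x, P x ∂μ + ∫ x, Y x ∂μ)) := by
    have hcont : Continuous fun δ : ℝ =>
        (1 - δ) * (∫ x, P x ∂μ) + (1 - 2 * δ) * (∫ x, Y x ∂μ) := by fun_prop
    simpa using (hcont.tendsto 0).mono_left nhdsWithin_le_nhds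
  exact le_of_tendsto hc (eventually_nhdsWithin_of_forall hδ)

variable {N : ℕ}

/-- The weak Laplacian as the trace of the weak Hessian. -/
theorem hasWeakLaplacian_sum {f : EuclideanSpace ℝ (Fin N) → ℝ}
    {G H : Fin N → EuclideanSpace ℝ (Fin N) → ℝ} (hf : LocallyIntegrable f volume)
    (hG : ∀ i, HasWeakPartial i f (G i)) (hH : ∀ i, HasWeakPartial i (G i) (H i)) :
    HasWeakLaplacian f fun x => ∑ i, H i x := by
  refine ⟨hf, locallyIntegrable_finsetSum _ fun i _ => (hH i).2.1, fun φ hφ => ?_⟩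
  simp only [hφ.1.laplacian_eq_sum, Finset.mul_sum, Finset.sum_mul]
  rw [integral_finsetSum _ fun i _ => integrable_mul_of_hasCompactSupport hf
      ((hφ.partialDeriv i).partialDeriv i).1.continuous ((hφ.partialDeriv i).partialDeriv i).2,
    integral_finsetSum _ fun i _ =>
      integrable_mul_of_hasCompactSupport (hH i).2.1 hφ.1.continuous hφ.2]
  refine Finset.sum_congr rfl fun i _ => ?_
  have h1 := (hG i).2.2 _ (hφ.partialDeriv i)
  have h2 := (hH i).2.2 φ hφ
  unfold partialDeriv at h1 ⊢
  rw [h1, h2, neg_neg]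

theorem tendsto_integral_indicator_norm_ge {τ : EuclideanSpace ℝ (Fin N) → ℝ} (hτ : Integrable τ)
    (R : ℝ) :
    Tendsto (fun n : ℕ => ∫ x, {x | R + n ≤ ‖x‖}.indicator τ x) atTop (𝓝 0) := by
  rw [← integral_zero (EuclideanSpace ℝ (Fin N)) ℝ (μ := volume)]
  refine tendsto_integral_of_dominated_convergence (fun x => ‖τ x‖) (fun n => ?_) hτ.norm
    (fun n => Eventually.of_forall fun x => norm_indicator_le_norm_self τ x)
    (Eventually.of_forall fun x => ?_)
  · exact hτ.1.indicator (measurableSet_le measurable_const measurable_norm)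
  · refine tendsto_const_nhds.congr' ?_
    obtain ⟨m, hm⟩ := exists_nat_gt (‖x‖ - R)
    filter_upwards [eventually_ge_atTop m] with n hn
    have : (m : ℝ) ≤ n := Nat.cast_le.2 hn
    rw [Set.indicator_of_notMem]
    simp only [Set.mem_ofPred_eq, not_le]
    linarith

end Global

theorem lemma3p1 (N : ℕ) (hN : 4 < N) (lam q θ C₁ C₂ α : ℝ)
    (hlam : 0 < lam) (hθ0 : 0 ≤ θ) (hθ4 : θ < 4) (hC₁ : 0 < C₁) (hC₂ : 0 < C₂)
    (V a : EuclideanSpace ℝ (Fin N) → ℝ)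
    (hV : LocallyIntegrable V volume) (ha : LocallyIntegrable a volume)
    (hV0 : ∀ᵐ x, 0 ≤ V x) (ha0 : ∀ᵐ x, 0 ≤ a x)
    (hlarge : ∃ R₀ : ℝ, ∀ᵐ x : EuclideanSpace ℝ (Fin N), R₀ ≤ ‖x‖ →
      V x ≤ C₁ / ‖x‖ ^ 4 ∧ C₂ / ‖x‖ ^ θ ≤ a x)
    (hHardy : HardyInequality V)
    (u : EuclideanSpace ℝ (Fin N) → ℝ) (hu : IsWeakSubharmonicSolution lam q V a u)
    (hα : 2 < α) (hq1 : 1 < q) (hq : q < ((N : ℝ) + α * (4 - θ) - θ) / ((N : ℝ) - 4)) :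
    (Integrable (fun x => u x ^ (q + α) * a x) volume ∧
      Integrable (fun x => u x ^ (α + 1) * V x) volume) ∧
    (HasWeakLaplacian (fun x => u x ^ α) (weakLaplacian fun x => u x ^ α) ∧
      Integrable (fun x => weakLaplacian u x * weakLaplacian (fun y => u y ^ α) x) volume ∧
      (∫ x, u x ^ (α + q) * a x) + ∫ x, weakLaplacian (fun y => u y ^ α) x * weakLaplacian u x ≤
        lam * ∫ x, u x ^ (α + 1) * V x) := by
  obtain ⟨R₀, hR₀⟩ := hlarge
  obtain ⟨-, G, H, hG, hH⟩ := hu.memW22Loc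
  have hu0 := hu.nonneg
  have huL := hu.memLinftyLoc
  have huloc : LocallyIntegrable u volume := huL.locallyIntegrable le_top
  have hsum : HasWeakLaplacian u fun x => ∑ i, H i i x :=
    hasWeakLaplacian_sum huloc (fun i => (hG i).2) fun i => (hH i i).2
  have hLap := hsum.hasWeakLaplacian_weakLaplacian
  have hLeq := hsum.ae_eq
  have hL0 := hu.laplacian_nonneg
  have hineq := hu.ineq
  obtain ⟨L, hLdef⟩ : ∃ L, L = weakLaplacian u := ⟨_, rfl⟩
  rw [← hLdef] at hLap hLeq hL0 hineq ⊢
  have hL2 : LocallyIntegrable (fun x => L x ^ 2) volume := by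
    have h1 : MemLpLoc L 2 := fun K hK =>
      (memLp_finsetSum Finset.univ fun i _ => (hH i i).1 K hK).ae_eq
        (ae_restrict_of_ae hLeq.symm)
    exact h1.locallyIntegrable_sq
  have hG2 : ∀ i, LocallyIntegrable (fun x => G i x ^ 2) volume := fun i =>
    (hG i).1.locallyIntegrable_sq
  obtain ⟨w, D, hw⟩ := exists_isSmoothApprox hu0 huL hLap hL0 (fun i => (hG i).2) hG2
  have hα2 : 2 ≤ α := hα.le
  have hα0 : 0 < α := by linarith
  have hq1' : 0 < q - 1 := by linarith
  have hqα : 0 < q + α := by linarith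
  have hΔ : HasWeakLaplacian (fun x => u x ^ α) (rpowLaplacian α u L G) :=
    hw.hasWeakLaplacian_rpow hα2 hu0 huL hLap.2.1 hG2
  have hN0 : (0 : ℝ) < (N : ℝ) - 4 := by
    have : (4 : ℝ) < N := by exact_mod_cast hN
    linarith
  -- the exponent of the remainder in Young's inequality is integrable at infinity: this is `hq`
  obtain ⟨s, hs⟩ : ∃ s : ℝ, s = (4 - θ) * ((q + α) / (q - 1)) + θ := ⟨_, rfl⟩
  have hsN : (N : ℝ) < s := by
    rw [lt_div_iff₀ hN0] at hq
    have h1 : s = ((4 - θ) * (q + α) + θ * (q - 1)) / (q - 1) := by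
      rw [hs]
      field_simp
    rw [h1, lt_div_iff₀ hq1']
    linarith
  obtain ⟨τ, hτdef⟩ : ∃ τ : EuclideanSpace ℝ (Fin N) → ℝ, τ = fun x => (1 + ‖x‖) ^ (-s) := ⟨_, rfl⟩
  have hτ : Integrable τ := by
    rw [hτdef]
    exact integrable_one_add_norm (by simpa using hsN)
  have hτ0 : ∀ x, 0 ≤ τ x := fun x => by
    rw [hτdef]
    positivity
  obtain ⟨R, hRdef⟩ : ∃ R, R = max R₀ 1 := ⟨_, rfl⟩
  have hR1 : 1 ≤ R := hRdef ▸ le_max_right _ _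
  have hR : ∀ᵐ x : EuclideanSpace ℝ (Fin N), R ≤ ‖x‖ →
      V x ≤ C₁ / ‖x‖ ^ 4 ∧ C₂ / ‖x‖ ^ θ ≤ a x := by
    filter_upwards [hR₀] with x hx h1
    exact hx ((hRdef ▸ le_max_left _ _ : R₀ ≤ R).trans h1)
  -- a power of the cutoff that is large enough for Young's inequality
  obtain ⟨k, hk⟩ := exists_nat_ge (4 * ((q + α) / (q - 1)) + 1)
  have hk0 : k ≠ 0 := by
    rintro rfl
    have : 0 < (q + α) / (q - 1) := div_pos hqα hq1'
    norm_num at hk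
    linarith
  have hk4 : 4 * ((q + α) / (q - 1)) ≤ k + 4 := by linarith
  obtain ⟨C, hC0, hcut⟩ := exists_isCutoff N hk0
  have hcut' : ∀ n : ℕ, ∃ η χ Θ : EuclideanSpace ℝ (Fin N) → ℝ, IsCutoff k C (R + n) η χ Θ :=
    fun n => hcut _ (by positivity)
  choose η χ Θ hc using hcut'
  obtain ⟨P, hPdef⟩ : ∃ P : EuclideanSpace ℝ (Fin N) → ℝ, P = fun x => u x ^ (q + α) * a x :=
    ⟨_, rfl⟩
  obtain ⟨Q, hQdef⟩ : ∃ Q : EuclideanSpace ℝ (Fin N) → ℝ, Q = fun x => u x ^ (α + 1) * V x :=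
    ⟨_, rfl⟩
  obtain ⟨Y, hYdef⟩ : ∃ Y : EuclideanSpace ℝ (Fin N) → ℝ,
    Y = fun x => L x * rpowLaplacian α u L G x := ⟨_, rfl⟩
  have hPloc : LocallyIntegrable P volume :=
    hPdef ▸ huL.locallyIntegrable_rpow_mul hu0 hqα.le ha
  have hQloc : LocallyIntegrable Q volume :=
    hQdef ▸ huL.locallyIntegrable_rpow_mul hu0 (by linarith) hV
  have hP0 : ∀ᵐ x, 0 ≤ P x := by
    filter_upwards [hu0, ha0] with x h1 h2
    rw [hPdef]
    positivity
  have hQ0 : ∀ᵐ x, 0 ≤ Q x := by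
    filter_upwards [hu0, hV0] with x h1 h2
    rw [hQdef]
    positivity
  have hY0 : ∀ᵐ x, 0 ≤ Y x := by
    filter_upwards [hu0, hL0] with x h1 h2
    rw [hYdef]
    exact (mul_nonneg hα0.le (mul_nonneg (sq_nonneg _) (Real.rpow_nonneg h1 _))).trans
      (mul_sq_le_mul_rpowLaplacian (by linarith) h1 h2)
  have hh : LocallyIntegrable (fun x => u x ^ q * a x) volume :=
    huL.locallyIntegrable_rpow_mul hu0 (by linarith) ha
  have hf : LocallyIntegrable (fun x => lam * u x * V x) volume := by
    have h1 := (huL.locallyIntegrable_rpow_mul hu0 zero_le_one hV).smul lam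
    simp only [Real.rpow_one] at h1
    refine (locallyIntegrable_congr (Filter.Eventually.of_forall fun x => ?_)).1 h1
    simp [mul_assoc]
  have hhP : ∀ᵐ x, u x ^ q * a x * u x ^ α = P x := by
    filter_upwards [hu0] with x h1
    rw [hPdef]
    simp only
    rw [Real.rpow_add_of_nonneg h1 (by linarith) hα0.le]
    ring
  have hfQ : ∀ᵐ x, lam * u x * V x * u x ^ α = lam * Q x := by
    filter_upwards [hu0] with x h1
    rw [hQdef]
    simp only
    rw [Real.rpow_add_of_nonneg h1 hα0.le zero_le_one, Real.rpow_one]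
    ring
  -- Young's inequality with the weight `a`, outside a large ball
  have young : ∀ A δ : ℝ, 0 ≤ A → 0 < δ → ∃ K : ℝ, 0 ≤ K ∧ ∀ᵐ x : EuclideanSpace ℝ (Fin N),
      R ≤ ‖x‖ → ∀ e : ℝ, 0 ≤ e → e ≤ 1 →
        A / ‖x‖ ^ 4 * e ^ k * u x ^ (α + 1) ≤ δ * (P x * e ^ (k + 4)) + K * τ x := by
    intro A δ hA hδ
    obtain ⟨K, hK0, hK⟩ := exists_young_weighted hα0 hq1 hθ0 hθ4.le hk0 hk4 hA
      (mul_pos hδ hC₂)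
    refine ⟨K, hK0, ?_⟩
    filter_upwards [hu0, hR] with x h1 h2 h3 e he0 he1
    refine (hK (u x) ‖x‖ e h1 (hR1.trans h3) he0 he1).trans ?_
    rw [hτdef, hPdef, ← hs]
    refine add_le_add ?_ le_rfl
    have h4 := mul_le_mul_of_nonneg_left (h2 h3).2
      (by positivity : 0 ≤ δ * (e ^ (k + 4) * u x ^ (q + α)))
    calc δ * C₂ / ‖x‖ ^ θ * e ^ (k + 4) * u x ^ (q + α)
        = δ * (e ^ (k + 4) * u x ^ (q + α)) * (C₂ / ‖x‖ ^ θ) := by ring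
      _ ≤ δ * (e ^ (k + 4) * u x ^ (q + α)) * a x := h4
      _ = _ := by ring
  obtain ⟨K₀, hK₀, hV1⟩ := young (lam * C₁) (1 / 4) (by positivity) (by norm_num)
  have hball : MeasurableSet (Metric.closedBall (0 : EuclideanSpace ℝ (Fin N)) R) :=
    Metric.isClosed_closedBall.measurableSet
  -- `F` takes the bounded region, where `V` is only integrable, and Young's remainder outside it
  obtain ⟨F, hFdef⟩ : ∃ F : EuclideanSpace ℝ (Fin N) → ℝ,
    F = fun x => (Metric.closedBall 0 R).indicator (fun y => lam * Q y) x + K₀ * τ x := ⟨_, rfl⟩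
  have hF : Integrable F := by
    rw [hFdef]
    refine Integrable.add ?_ (hτ.const_mul K₀)
    rw [integrable_indicator_iff hball]
    exact (hQloc.integrableOn_isCompact (isCompact_closedBall _ _)).const_mul lam
  have hind : ∀ᵐ x, 0 ≤ (Metric.closedBall (0 : EuclideanSpace ℝ (Fin N)) R).indicator
      (fun y => lam * Q y) x := by
    filter_upwards [hQ0] with x hx
    by_cases hxR : x ∈ Metric.closedBall (0 : EuclideanSpace ℝ (Fin N)) R
    · rw [Set.indicator_of_mem hxR]
      exact mul_nonneg hlam.le hx
    · rw [Set.indicator_of_notMem hxR]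
  have hQP : ∀ᵐ x, lam * Q x ≤ 1 / 4 * P x + F x := by
    filter_upwards [hP0, hV1, hR, hu0] with x h1 h2 h3 h4
    rw [hFdef]
    by_cases hxR : x ∈ Metric.closedBall (0 : EuclideanSpace ℝ (Fin N)) R
    · simp only
      rw [Set.indicator_of_mem hxR]
      have := mul_nonneg hK₀ (hτ0 x)
      linarith
    · simp only
      rw [Set.indicator_of_notMem hxR]
      rw [Metric.mem_closedBall, dist_zero_right, not_le] at hxR
      have h5 := h2 hxR.le 1 zero_le_one le_rfl
      simp only [one_pow, mul_one] at h5
      have h6 : lam * Q x ≤ lam * C₁ / ‖x‖ ^ 4 * u x ^ (α + 1) := by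
        rw [hQdef]
        have h7 := mul_le_mul_of_nonneg_left (h3 hxR.le).1
          (by positivity : 0 ≤ lam * u x ^ (α + 1))
        calc lam * (u x ^ (α + 1) * V x) = lam * u x ^ (α + 1) * V x := by ring
          _ ≤ lam * u x ^ (α + 1) * (C₁ / ‖x‖ ^ 4) := h7
          _ = _ := by ring
      linarith
  have hF0 : ∀ᵐ x, 0 ≤ F x := by
    filter_upwards [hind] with x hx
    rw [hFdef]
    exact add_nonneg hx (mul_nonneg hK₀ (hτ0 x))
  have henergy : ∀ δ : ℝ, 0 < δ → ∃ K : ℝ, ∀ n,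
      Integrable (fun x => Y x * η n x ^ (k + 4)) ∧
      (1 - δ) * (∫ x, P x * η n x ^ (k + 4)) + (1 - 2 * δ) * (∫ x, Y x * η n x ^ (k + 4)) ≤
        lam * (∫ x, Q x * η n x ^ (k + 4)) + K * ∫ x, {x | R + n ≤ ‖x‖}.indicator τ x := by
    intro δ hδ
    obtain ⟨K, -, hK⟩ := young (2 / δ * C) δ (by positivity) hδ
    refine ⟨K, fun n => ?_⟩
    rw [hYdef]
    refine hw.absorbed_energy_inequality hα2 hδ hu0 hLap.2.1 hL2 hL0 hh hf hineq hPloc hP0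
      hhP hfQ hτ (hc n) ?_
    filter_upwards [hK] with x hx hRx
    have h1 : (0 : ℝ) ≤ n := Nat.cast_nonneg n
    have := hx (by linarith) (η n x) ((hc n).nonneg x) ((hc n).le_one x)
    rwa [mul_div_assoc] at this
  have hYint : ∀ n, Integrable fun x => Y x * η n x ^ (k + 4) := fun n => by
    obtain ⟨K, hK⟩ := henergy 1 one_pos
    exact (hK n).1
  have hψt := fun n => (hc n).isTestFunction_pow
  have hψlim : ∀ x, Filter.Tendsto (fun n => η n x ^ (k + 4)) Filter.atTop (nhds 1) := fun x => by
    refine tendsto_const_nhds.congr' ?_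
    obtain ⟨m, hm⟩ := exists_nat_ge ‖x‖
    filter_upwards [Filter.eventually_ge_atTop m] with n hn
    have : (m : ℝ) ≤ n := Nat.cast_le.2 hn
    rw [(hc n).eq_one x (by linarith), one_pow]
  obtain ⟨hPi, hQi, hYi, hfin⟩ := integrable_and_add_le_of_cutoff hlam hP0 hQ0 hY0
    hQloc.aestronglyMeasurable (fun n x => pow_nonneg ((hc n).nonneg x) _)
    (fun n x => pow_le_one₀ ((hc n).nonneg x) ((hc n).le_one x)) hψlim
    (fun n => integrable_mul_of_hasCompactSupport hPloc (hψt n).1.continuous (hψt n).2)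
    (fun n => integrable_mul_of_hasCompactSupport hQloc (hψt n).1.continuous (hψt n).2)
    hYint hF hQP hF0 (tendsto_integral_indicator_norm_ge hτ R)
    (fun δ hδ => (henergy δ hδ).imp fun K hK n => (hK n).2)
  have hY' : Y =ᵐ[volume] fun x => L x * weakLaplacian (fun y => u y ^ α) x := by
    filter_upwards [hΔ.ae_eq] with x hx
    rw [hYdef, hx]
  refine ⟨⟨hPdef ▸ hPi, hQdef ▸ hQi⟩, hΔ.hasWeakLaplacian_weakLaplacian, hYi.congr hY', ?_⟩
  rw [integral_congr_ae hY', hPdef, hQdef] at hfin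
  simpa only [add_comm α q, mul_comm (L _)] using hfin
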